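/- **Theorem (exact integrated squared bias and integrated variance of kernel distribution function estimators for normal mixtures).** Let $\phi$ and $\Phi$ be the standard normal density and distribution function, let $\phi^{(k)}$ be the $k$-th derivative of $\phi$ for $k\ge 0$, and put $\phi^{(-1)}(x)=\Phi(x)$, $\phi^{(-2)}(x)=\phi(x)+x\Phi(x)$. For $r=1,2,3,\dots$ let $$g_{2r}(x)=\sum_{s=0}^{r-1}\frac{(-1)^s}{2^s s!}\phi^{(2s)}(x),\qquad G_{2r}(x)=\int_{-\infty}^x g_{2r}(z)\,dz$$ be the Gaussian-based kernels of order $2r$. Let $X_1,\dots,X_n$ ($n\ge 1$) be i.i.d. random variables with density $f(x)=\sum_{j=1}^m w_j\,\sigma_j^{-1}\phi((x-\mu_j)/\sigma_j)$, where $\mu_j\in\mathbb R$, $\sigma_j>0$, $w_j>0$, $\sum_{j=1}^m w_j=1$, and let $F(x)=\int_{-\infty}^x f(z)\,dz$. For $h>0$ let $$\widehat F_{2r}(x;h)=\frac1n\sum_{i=1}^n G_{2r}\big(h^{-1}(x-X_i)\big).$$ For integers $p,q\ge 0$ put $\sigma_{ij,q}=\sqrt{\sigma_i^2+\sigma_j^2+qh^2}$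 and $$V(h;p,q)=h^{2p}\sum_{i=1}^m\sum_{j=1}^m w_iw_j\,\sigma_{ij,q}^{1-2p}\,\phi^{(2p-2)}\Big(\frac{\mu_j-\mu_i}{\sigma_{ij,q}}\Big).$$ Let $\mathrm{OF}(2k)=\prod_{i=1}^k(2i-1)$ and $\mathrm{OF}(-2k)=(-1)^k/\mathrm{OF}(2k)$ for $k\ge1$, and $\mathrm{OF}(0)=1$. Let $I_z(\alpha,\beta)$ be the regularized incomplete beta function, and let $$C(r)=\sqrt\pi\,\psi_1(G_{2r}),\qquad \psi_1(G_{2r})=2\int_{-\infty}^{\infty}x\,G_{2r}(x)\,g_{2r}(x)\,dx .$$ Then for every $h>0$ and every $r=1,2,3,\dots$, each $\widehat F_{2r}(x;h)$ is square integrable, the integrals over $x$ below and the one defining $\psi_1(G_{2r})$ converge absolutely, and $$\int_{-\infty}^{\infty}\big(\mathbb E[\widehat F_{2r}(x;h)]-F(x)\big)^2dx=-\sum_{s=0}^{r-1}\sum_{t=0}^{r-1}\frac{(-1)^{s+t}}{2^{s+t}s!\,t!}V(h;s+t,2)+2\sum_{s=0}^{r-1}\frac{(-1)^s}{2^s s!}V(h;s,1)-V(h;0,0),$$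 $$\int_{-\infty}^{\infty}\mathrm{Var}[\widehat F_{2r}(x;h)]\,dx=-\frac{h}{n\sqrt\pi}C(r)+\frac1n\sum_{s=0}^{r-1}\sum_{t=0}^{r-1}\frac{(-1)^{s+t}}{2^{s+t}s!\,t!}V(h;s+t,2).$$ Moreover $$C(r)=-\sum_{s=0}^{r-1}\sum_{t=0}^{r-1}\frac{\mathrm{OF}(2s+2t-2)}{2^{2s+2t}s!\,t!}=\frac{\Gamma(2r-3/2)}{\sqrt\pi\,\Gamma(2r-1)}+\sum_{s=0}^{r-2}\frac{\Gamma(r+s-1/2)}{\sqrt\pi\,\Gamma(r+s+1)}\,I_{1/2}(r,s+1),$$ where the last sum is zero when $r=1$. -/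

import Mathlib

open MeasureTheory ProbabilityTheory
open scoped Nat

noncomputable section

/-- The standard normal density `φ`. -/
def stdNormalPDF (x : ℝ) : ℝ := gaussianPDFReal 0 1 x

/-- The standard normal distribution function `Φ`. -/
def stdNormalCDF (x : ℝ) : ℝ := cdf (gaussianReal 0 1) x

/-- `φ^{(k)}`: the `k`-th derivative of `φ` for `k ≥ 0`, with `φ^{(-1)} = Φ` and
`φ^{(-2)}(x) = φ(x) + x Φ(x)`. Indices below `-2` do not occur (the value there is `0`). -/
def normalDeriv (k : ℤ) (x : ℝ) : ℝ :=
  match k with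
  | Int.ofNat r => iteratedDeriv r stdNormalPDF x
  | Int.negSucc 0 => stdNormalCDF x
  | Int.negSucc 1 => stdNormalPDF x + x * stdNormalCDF x
  | Int.negSucc (_ + 2) => 0

/-- The density `f(x) = ∑ j, w j * φ(x; μ j, (σ j)²)` of a finite normal mixture. -/
def mixturePDF {m : ℕ} (w μ σ : Fin m → ℝ) (x : ℝ) : ℝ :=
  ∑ j, w j * gaussianPDFReal (μ j) ⟨σ j ^ 2, sq_nonneg (σ j)⟩ x

/-- The distribution function `F(x) = ∫_{-∞}^x f` of a finite normal mixture. -/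
def mixtureCDF {m : ℕ} (w μ σ : Fin m → ℝ) (x : ℝ) : ℝ :=
  ∫ z in Set.Iic x, mixturePDF w μ σ z

/-- The finite normal mixture, as a measure on `ℝ`. -/
def mixtureMeasure {m : ℕ} (w μ σ : Fin m → ℝ) : Measure ℝ :=
  volume.withDensity fun x => ENNReal.ofReal (mixturePDF w μ σ x)

/-- The Gaussian-based density kernel `g_{2r}` of order `2r`. -/
def gaussKernel (r : ℕ) (x : ℝ) : ℝ :=
  ∑ s ∈ Finset.range r, (-1 : ℝ) ^ s / (2 ^ s * (s ! : ℝ)) * normalDeriv (2 * (s : ℤ)) x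

/-- The integrated kernel `K(z) = ∫_{-∞}^z k`. -/
def integratedKernel (k : ℝ → ℝ) (z : ℝ) : ℝ := ∫ v in Set.Iic z, k v

/-- The Gaussian-based kernel `G_{2r}(x) = ∫_{-∞}^x g_{2r}` for distribution functions. -/
def gaussKernelCDF (r : ℕ) : ℝ → ℝ := integratedKernel (gaussKernel r)

/-- The kernel distribution function estimator `n⁻¹ ∑ i, K(h⁻¹ (x - X i))` with (integrated)
kernel `K` and bandwidth `h > 0`, as a random variable for each `x`. -/
def kdfe {Ω : Type*} {n : ℕ} (K : ℝ → ℝ) (X : Fin n → Ω → ℝ) (h x : ℝ) (ω : Ω) : ℝ :=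
  (n : ℝ)⁻¹ * ∑ i, K (h⁻¹ * (x - X i ω))

/-- Integrated squared bias of an estimator `Fhat x` of `F x`. -/
def integratedSqBias {Ω : Type*} [MeasurableSpace Ω] (P : Measure Ω)
    (Fhat : ℝ → Ω → ℝ) (F : ℝ → ℝ) : ℝ :=
  ∫ x, ((∫ ω, Fhat x ω ∂P) - F x) ^ 2

/-- Integrated variance of an estimator `Fhat x`. -/
def integratedVar {Ω : Type*} [MeasurableSpace Ω] (P : Measure Ω) (Fhat : ℝ → Ω → ℝ) : ℝ :=
  ∫ x, variance (Fhat x) P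

/-- `ψ₁(K) = 2 ∫ x K(x) k(x) dx`, as a function of `k`, where `K(z) = ∫_{-∞}^z k`. -/
def psiOne (k : ℝ → ℝ) : ℝ := 2 * ∫ x, x * integratedKernel k x * k x

/-- The constant `C(r) = √π ψ₁(G_{2r})`. -/
def kernelConst (r : ℕ) : ℝ := √Real.pi * psiOne (gaussKernel r)

/-- `σ_{ij,q} = √(σ_i² + σ_j² + q h²)`. -/
def pairScale {m : ℕ} (σ : Fin m → ℝ) (h : ℝ) (q : ℕ) (i j : Fin m) : ℝ :=
  √(σ i ^ 2 + σ j ^ 2 + q * h ^ 2)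

/-- `V(h; p, q)`. -/
def mixtureV {m : ℕ} (w μ σ : Fin m → ℝ) (h : ℝ) (p q : ℕ) : ℝ :=
  h ^ (2 * p) * ∑ i, ∑ j, w i * w j * pairScale σ h q i j ^ (1 - 2 * (p : ℤ)) *
    normalDeriv (2 * (p : ℤ) - 2) ((μ j - μ i) / pairScale σ h q i j)

/-- The odd factorial: `OF(2k) = ∏_{i=1}^k (2i-1)` and `OF(-2k) = (-1)^k / OF(2k)` for `k ≥ 1`,
`OF(0) = 1`, and `OF(a) = 0` for odd `a`. -/
def oddFactorial (a : ℤ) : ℝ :=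
  if Odd a then 0
  else if 0 ≤ a then ∏ i ∈ Finset.Icc 1 (a.natAbs / 2), (2 * (i : ℝ) - 1)
  else (-1) ^ (a.natAbs / 2) / ∏ i ∈ Finset.Icc 1 (a.natAbs / 2), (2 * (i : ℝ) - 1)

/-- The regularized incomplete beta function `I_z(a, b)`, for `a, b > 0` and `z ∈ [0, 1]`. -/
def regIncBeta (z a b : ℝ) : ℝ :=
  (∫ t in (0 : ℝ)..z, t ^ (a - 1) * (1 - t) ^ (b - 1)) / ProbabilityTheory.beta a b

end

noncomputable section

open Filter Topology

/-! Let `scaledNormal k τ` be the `k`-th derivative of `τ φ^{(-2)}(x / τ)`, the second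
antiderivative of the `N(0, τ²)` density. Convolution with a centred normal density keeps this
family and adds variances (`integral_scaledNormal_sub_mul`). Hence `G_{2r}`, `F`, the mean of the
estimator and its bias are all finite linear combinations `M` of translates of even derivatives of
normal distribution functions.

The central identity is `integral_normalComb_mul_mass_sub`. If `κ` is the limit of `M` at `+∞`,
integration by parts gives `∫ M (κ - M) = ∫ M⁽⁻¹⁾ M'`, and every product in the expanded right side
integrates to one normal derivative with pooled variance. It is used three times: for the bias (`κ =
0`, which gives minus the integrated square), for the mean of the estimator (`κ = 1`), and for the
kernel (`κ = 1`).

For the variance, let `m(x)` be the mean and `K` the kernel value at one observation. Then `n Var =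
m (1 - m) - E[K (1 - K)]`. The first term is covered by the identity. Fubini and rescaling turn the
second into `h ∫ G (1 - G)`, which is `h ψ₁` by another integration by parts (`psiOne_gaussKernel`).

For the kernel the normal derivatives are taken at `0`, where Hermite constants give the odd
factorial sum for `C(r)`. Odd factorials are values `Γ(N - 1/2)`, and the double sum is grouped by
`N = s + t`. The binomial coefficients that occur for `N` sum to `2^N` minus two equal tails. The
`2^N` part telescopes to one Gamma quotient, and the tails are incomplete beta values at `1/2`
(`regIncBeta_half`). -/

/-! ### Derivatives, antiderivatives and tails of the standard normal density. -/

lemma stdNormalPDF_eq (x : ℝ) :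
    stdNormalPDF x = (√(2 * Real.pi))⁻¹ * Real.exp (-(x ^ 2 / 2)) := by
  simp [stdNormalPDF, gaussianPDFReal, neg_div]

lemma contDiff_stdNormalPDF {n : WithTop ℕ∞} : ContDiff ℝ n stdNormalPDF := by
  rw [funext stdNormalPDF_eq]
  fun_prop

lemma iteratedDeriv_stdNormalPDF (n : ℕ) (x : ℝ) :
    iteratedDeriv n stdNormalPDF x =
      (-1) ^ n * Polynomial.aeval x (Polynomial.hermite n) * stdNormalPDF x := by
  have h : iteratedDeriv n stdNormalPDF x = (√(2 * Real.pi))⁻¹ *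
      iteratedDeriv n (fun y => Real.exp (-(y ^ 2 / 2))) x := by
    rw [funext stdNormalPDF_eq, iteratedDeriv_const_mul_field]
  rw [h, iteratedDeriv_eq_iterate, Polynomial.deriv_gaussian_eq_hermite_mul_gaussian,
    stdNormalPDF_eq]
  ring

lemma normalDeriv_natCast (n : ℕ) (x : ℝ) :
    normalDeriv (n : ℤ) x = iteratedDeriv n stdNormalPDF x := rfl

lemma normalDeriv_neg_one (x : ℝ) : normalDeriv (-1) x = stdNormalCDF x := rfl

lemma normalDeriv_neg_two (x : ℝ) :
    normalDeriv (-2) x = stdNormalPDF x + x * stdNormalCDF x := rfl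

lemma integrable_stdNormalPDF : Integrable stdNormalPDF := integrable_gaussianPDFReal 0 1

lemma stdNormalCDF_eq_integral (x : ℝ) :
    stdNormalCDF x = ∫ z in Set.Iic x, stdNormalPDF z := by
  rw [stdNormalCDF, cdf_eq_real, measureReal_def, gaussianReal_apply_eq_integral _ one_ne_zero,
    ENNReal.toReal_ofReal]
  · rfl
  · exact setIntegral_nonneg measurableSet_Iic fun _ _ => gaussianPDFReal_nonneg _ _ _

lemma hasDerivAt_integral_Iic {f : ℝ → ℝ} (hf : Integrable f) (hc : Continuous f) (x : ℝ) :
    HasDerivAt (fun y => ∫ z in Set.Iic y, f z) (f x) x := by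
  have h : (fun y => ∫ z in Set.Iic y, f z) =
      fun y => (∫ z in Set.Iic 0, f z) + ∫ z in (0 : ℝ)..y, f z := by
    ext y
    rw [← intervalIntegral.integral_Iic_sub_Iic hf.integrableOn hf.integrableOn]
    ring
  rw [h]
  exact (intervalIntegral.integral_hasDerivAt_right (hc.intervalIntegrable _ _)
    hc.stronglyMeasurable.stronglyMeasurableAtFilter hc.continuousAt).const_add _

lemma hasDerivAt_stdNormalCDF (x : ℝ) : HasDerivAt stdNormalCDF (stdNormalPDF x) x := by
  rw [funext stdNormalCDF_eq_integral]
  exact hasDerivAt_integral_Iic integrable_stdNormalPDF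
    (contDiff_stdNormalPDF (n := 0)).continuous x

lemma hasDerivAt_iteratedDeriv_stdNormalPDF (n : ℕ) (x : ℝ) :
    HasDerivAt (iteratedDeriv n stdNormalPDF) (iteratedDeriv (n + 1) stdNormalPDF x) x := by
  rw [iteratedDeriv_succ]
  exact ((contDiff_stdNormalPDF (n := ⊤)).differentiable_iteratedDeriv n
    (by exact_mod_cast WithTop.coe_lt_top _) x).hasDerivAt

lemma hasDerivAt_stdNormalPDF (x : ℝ) :
    HasDerivAt stdNormalPDF (-x * stdNormalPDF x) x := by
  have h := hasDerivAt_iteratedDeriv_stdNormalPDF 0 x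
  rw [iteratedDeriv_stdNormalPDF] at h
  simpa using h

/-- Shifting the order by two lets one natural index cover `φ^{(-2)}`, `Φ` and all derivatives of
`φ`. At order `-2` the term `φ' = -xφ` cancels the `xφ` from the product rule. -/
lemma hasDerivAt_normalDeriv (k : ℕ) (x : ℝ) :
    HasDerivAt (normalDeriv ((k : ℤ) - 2)) (normalDeriv ((k : ℤ) + 1 - 2) x) x := by
  match k with
  | 0 =>
    have h := (hasDerivAt_stdNormalPDF x).add ((hasDerivAt_id x).mul (hasDerivAt_stdNormalCDF x))
    refine HasDerivAt.congr_deriv h ?_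
    change _ = stdNormalCDF x
    simp only [id]
    ring
  | 1 => exact hasDerivAt_stdNormalCDF x
  | n + 2 =>
    have h1 : ((n + 2 : ℕ) : ℤ) - 2 = (n : ℤ) := by push_cast; ring
    have h2 : ((n + 2 : ℕ) : ℤ) + 1 - 2 = ((n + 1 : ℕ) : ℤ) := by push_cast; ring
    rw [h1, h2]
    exact hasDerivAt_iteratedDeriv_stdNormalPDF n x

/-- `φ^{(k)}` decays faster than every exponential. -/
lemma exists_abs_iteratedDeriv_stdNormalPDF_le (n : ℕ) (a : ℝ) :
    ∃ C, ∀ x, |iteratedDeriv n stdNormalPDF x| ≤ C * Real.exp (-(a * |x|)) := by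
  have hpoly : ∀ p : Polynomial ℤ, ∃ C, 0 ≤ C ∧
      ∀ x : ℝ, |Polynomial.aeval x p| ≤ C * Real.exp |x| := by
    intro p
    -- Each monomial is absorbed through `|x|^i ≤ i! e^{|x|}`.
    refine ⟨∑ i ∈ Finset.range (p.natDegree + 1), |(p.coeff i : ℝ)| * i !, by positivity, ?_⟩
    intro x
    rw [Polynomial.aeval_eq_sum_range, Finset.sum_mul]
    refine (Finset.abs_sum_le_sum_abs _ _).trans (Finset.sum_le_sum fun i _ => ?_)
    have h := Real.pow_div_factorial_le_exp |x| (abs_nonneg x) i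
    rw [div_le_iff₀ (by positivity)] at h
    rw [zsmul_eq_mul, abs_mul, abs_pow, mul_assoc, mul_comm (i ! : ℝ)]
    gcongr
  obtain ⟨C, hC, h⟩ := hpoly (Polynomial.hermite n)
  -- Completing the square: `|x| - x²/2 ≤ (a+1)²/2 - a|x|`.
  refine ⟨C * (√(2 * Real.pi))⁻¹ * Real.exp ((a + 1) ^ 2 / 2), fun x => ?_⟩
  rw [iteratedDeriv_stdNormalPDF, stdNormalPDF_eq, abs_mul, abs_mul, abs_pow, abs_neg, abs_one,
    one_pow, one_mul, abs_of_nonneg (a := _ * Real.exp _) (by positivity)]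
  calc _ ≤ C * Real.exp |x| * ((√(2 * Real.pi))⁻¹ * Real.exp (-(x ^ 2 / 2))) := by
        gcongr
        exact h x
    _ = C * (√(2 * Real.pi))⁻¹ * Real.exp (|x| + -(x ^ 2 / 2)) := by
        rw [Real.exp_add]
        ring
    _ ≤ C * (√(2 * Real.pi))⁻¹ * Real.exp ((a + 1) ^ 2 / 2 + -(a * |x|)) := by
        refine mul_le_mul_of_nonneg_left (Real.exp_le_exp.mpr ?_) (by positivity)
        nlinarith [sq_nonneg (|x| - (a + 1)), sq_abs x]
    _ = _ := by
        rw [Real.exp_add]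
        ring

lemma stdNormalCDF_nonneg (x : ℝ) : 0 ≤ stdNormalCDF x := cdf_nonneg _ _

lemma stdNormalCDF_le_one (x : ℝ) : stdNormalCDF x ≤ 1 := cdf_le_one _ _

lemma one_sub_stdNormalCDF_eq_integral (x : ℝ) :
    1 - stdNormalCDF x = ∫ z in Set.Ioi x, stdNormalPDF z := by
  rw [stdNormalCDF_eq_integral, sub_eq_iff_eq_add', ← Set.compl_Iic,
    integral_add_compl measurableSet_Iic integrable_stdNormalPDF]
  exact (integral_gaussianPDFReal_eq_one 0 one_ne_zero).symm

lemma stdNormalPDF_neg (x : ℝ) : stdNormalPDF (-x) = stdNormalPDF x := by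
  simp [stdNormalPDF_eq]

lemma stdNormalCDF_neg (x : ℝ) : stdNormalCDF (-x) = 1 - stdNormalCDF x := by
  rw [one_sub_stdNormalCDF_eq_integral, stdNormalCDF_eq_integral, ← integral_comp_neg_Ioi]
  simp [stdNormalPDF_neg]

/-- Since `-a|z| ≤ az`, the density has an exponential majorant that integrates explicitly over
`(-∞, x]`. The freedom in the rate `a` later absorbs a linear factor in the second antiderivative.
-/
lemma exists_stdNormalCDF_le_exp {a : ℝ} (ha : 0 < a) :
    ∃ C, 0 ≤ C ∧ ∀ x, stdNormalCDF x ≤ C * Real.exp (a * x) := by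
  obtain ⟨C, hC⟩ := exists_abs_iteratedDeriv_stdNormalPDF_le 0 a
  simp only [iteratedDeriv_zero] at hC
  have hC0 : 0 ≤ C := by
    have h := hC 0
    simp only [abs_zero, mul_zero, neg_zero, Real.exp_zero, mul_one] at h
    exact (abs_nonneg _).trans h
  refine ⟨C / a, by positivity, fun x => ?_⟩
  have hint : IntegrableOn (fun z : ℝ => C * Real.exp (a * z)) (Set.Iic x) :=
    (integrableOn_exp_mul_Iic ha x).const_mul C
  calc stdNormalCDF x = ∫ z in Set.Iic x, stdNormalPDF z := stdNormalCDF_eq_integral x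
    _ ≤ ∫ z in Set.Iic x, C * Real.exp (a * z) := by
        refine setIntegral_mono integrable_stdNormalPDF.integrableOn hint fun z => ?_
        refine (le_abs_self _).trans ((hC z).trans ?_)
        gcongr
        nlinarith [neg_abs_le z]
    _ = _ := by
        rw [integral_const_mul, integral_exp_mul_Iic ha]
        ring

/-! ### Growth and decay classes. -/

/-- Exponential decay at rate one in both directions. -/
def ExpDecay (f : ℝ → ℝ) : Prop := ∃ C, ∀ x, |f x| ≤ C * Real.exp (-|x|)

/-- At most linear growth. -/
def LinGrowth (f : ℝ → ℝ) : Prop := ∃ C, ∀ x, |f x| ≤ C * (1 + |x|)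

lemma ExpDecay.exists_nonneg {f : ℝ → ℝ} (hf : ExpDecay f) :
    ∃ C, 0 ≤ C ∧ ∀ x, |f x| ≤ C * Real.exp (-|x|) := by
  obtain ⟨C, hC⟩ := hf
  refine ⟨C, ?_, hC⟩
  simpa using (abs_nonneg _).trans (hC 0)

lemma LinGrowth.exists_nonneg {f : ℝ → ℝ} (hf : LinGrowth f) :
    ∃ C, 0 ≤ C ∧ ∀ x, |f x| ≤ C * (1 + |x|) := by
  obtain ⟨C, hC⟩ := hf
  refine ⟨C, ?_, hC⟩
  simpa using (abs_nonneg _).trans (hC 0)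

lemma ExpDecay.const_mul {f : ℝ → ℝ} (hf : ExpDecay f) (c : ℝ) :
    ExpDecay (fun x => c * f x) := by
  obtain ⟨C, hC⟩ := hf
  refine ⟨|c| * C, fun x => ?_⟩
  rw [abs_mul, mul_assoc]
  exact mul_le_mul_of_nonneg_left (hC x) (abs_nonneg _)

lemma LinGrowth.const_mul {f : ℝ → ℝ} (hf : LinGrowth f) (c : ℝ) :
    LinGrowth (fun x => c * f x) := by
  obtain ⟨C, hC⟩ := hf
  refine ⟨|c| * C, fun x => ?_⟩
  rw [abs_mul, mul_assoc]
  exact mul_le_mul_of_nonneg_left (hC x) (abs_nonneg _)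

lemma ExpDecay.sum {ι : Type*} {s : Finset ι} {f : ι → ℝ → ℝ} (hf : ∀ i ∈ s, ExpDecay (f i)) :
    ExpDecay (fun x => ∑ i ∈ s, f i x) := by
  choose! C hC using hf
  refine ⟨∑ i ∈ s, C i, fun x => (Finset.abs_sum_le_sum_abs _ _).trans ?_⟩
  rw [Finset.sum_mul]
  exact Finset.sum_le_sum fun i hi => hC i hi x

lemma LinGrowth.sum {ι : Type*} {s : Finset ι} {f : ι → ℝ → ℝ} (hf : ∀ i ∈ s, LinGrowth (f i)) :
    LinGrowth (fun x => ∑ i ∈ s, f i x) := by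
  choose! C hC using hf
  refine ⟨∑ i ∈ s, C i, fun x => (Finset.abs_sum_le_sum_abs _ _).trans ?_⟩
  rw [Finset.sum_mul]
  exact Finset.sum_le_sum fun i hi => hC i hi x

lemma LinGrowth.add {f g : ℝ → ℝ} (hf : LinGrowth f) (hg : LinGrowth g) :
    LinGrowth (fun x => f x + g x) := by
  obtain ⟨C, hC⟩ := hf
  obtain ⟨D, hD⟩ := hg
  refine ⟨C + D, fun x => (abs_add_le _ _).trans ?_⟩
  rw [add_mul]
  exact add_le_add (hC x) (hD x)

lemma LinGrowth.of_abs_le {f : ℝ → ℝ} (C : ℝ) (hf : ∀ x, |f x| ≤ C) : LinGrowth f := by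
  refine ⟨C, fun x => (hf x).trans ?_⟩
  have hC : 0 ≤ C := (abs_nonneg _).trans (hf 0)
  nlinarith [abs_nonneg x, mul_nonneg hC (abs_nonneg x)]

lemma ExpDecay.exists_abs_le {f : ℝ → ℝ} (hf : ExpDecay f) : ∃ C, ∀ x, |f x| ≤ C := by
  obtain ⟨C, hC0, hC⟩ := hf.exists_nonneg
  refine ⟨C, fun x => (hC x).trans (mul_le_of_le_one_right hC0 ?_)⟩
  simp

lemma ExpDecay.linGrowth {f : ℝ → ℝ} (hf : ExpDecay f) : LinGrowth f :=
  let ⟨C, hC⟩ := hf.exists_abs_le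
  .of_abs_le C hC

lemma ExpDecay.comp_sub {f : ℝ → ℝ} (hf : ExpDecay f) (a : ℝ) : ExpDecay (fun x => f (x - a)) := by
  obtain ⟨C, hC0, hC⟩ := hf.exists_nonneg
  refine ⟨C * Real.exp |a|, fun x => (hC _).trans ?_⟩
  rw [mul_assoc, ← Real.exp_add]
  refine mul_le_mul_of_nonneg_left (Real.exp_le_exp.mpr ?_) hC0
  linarith [abs_sub_abs_le_abs_sub x a]

lemma LinGrowth.comp_sub {f : ℝ → ℝ} (hf : LinGrowth f) (a : ℝ) :
    LinGrowth (fun x => f (x - a)) := by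
  obtain ⟨C, hC0, hC⟩ := hf.exists_nonneg
  refine ⟨C * (1 + |a|), fun x => (hC _).trans ?_⟩
  rw [mul_assoc]
  refine mul_le_mul_of_nonneg_left ?_ hC0
  nlinarith [abs_sub x a, mul_nonneg (abs_nonneg a) (abs_nonneg x)]

lemma LinGrowth.id : LinGrowth (fun x => x) := ⟨1, fun x => by linarith⟩

lemma integrable_linGrowth_mul_expDecay {f g : ℝ → ℝ} (hg : LinGrowth g) (hf : ExpDecay f)
    (hgc : Continuous g) (hfc : Continuous f) : Integrable (fun x => g x * f x) := by
  obtain ⟨C, hC0, hC⟩ := hf.exists_nonneg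
  obtain ⟨D, hD0, hD⟩ := hg.exists_nonneg
  refine (integrable_inv_one_add_sq.const_mul (D * C * 10)).mono'
    (hgc.mul hfc).aestronglyMeasurable (ae_of_all _ fun x => ?_)
  rw [Real.norm_eq_abs, abs_mul]
  -- With `u = |x|`, the bounds `u^k ≤ k! e^u` for `k ≤ 3` give `(1+u)(1+u²) ≤ (1+1+2+6) e^u`.
  have key : (1 + |x|) * Real.exp (-|x|) ≤ 10 * (1 + x ^ 2)⁻¹ := by
    rw [Real.exp_neg, ← div_eq_mul_inv, ← div_eq_mul_inv, div_le_div_iff₀ (by positivity)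
      (by positivity), ← sq_abs x]
    have h1 := Real.pow_div_factorial_le_exp |x| (abs_nonneg x) 1
    have h2 := Real.pow_div_factorial_le_exp |x| (abs_nonneg x) 2
    have h3 := Real.pow_div_factorial_le_exp |x| (abs_nonneg x) 3
    have h0 := Real.one_le_exp (abs_nonneg x)
    simp only [Nat.factorial, pow_one] at h1 h2 h3
    norm_num at h2 h3
    rw [sq_abs] at *
    rw [show |x| ^ 3 = |x| * x ^ 2 by rw [pow_succ, sq_abs, mul_comm]] at h3
    nlinarith
  calc |g x| * |f x| ≤ (D * (1 + |x|)) * (C * Real.exp (-|x|)) := by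
        gcongr
        · exact hD x
        · exact hC x
    _ = D * C * ((1 + |x|) * Real.exp (-|x|)) := by ring
    _ ≤ D * C * (10 * (1 + x ^ 2)⁻¹) := by gcongr
    _ = _ := by ring

lemma ExpDecay.integrable {f : ℝ → ℝ} (hf : ExpDecay f) (hc : Continuous f) : Integrable f := by
  simpa using integrable_linGrowth_mul_expDecay (.of_abs_le 1 (by simp)) hf
    (continuous_const (y := (1 : ℝ))) hc

lemma ExpDecay.tendsto_atBot {f : ℝ → ℝ} (hf : ExpDecay f) : Tendsto f atBot (𝓝 0) := by
  obtain ⟨C, hC⟩ := hf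
  refine squeeze_zero_norm hC ?_
  have h : Tendsto (fun x : ℝ => Real.exp (-|x|)) atBot (𝓝 0) :=
    Real.tendsto_exp_neg_atTop_nhds_zero.comp tendsto_abs_atBot_atTop
  simpa using h.const_mul C

/-! ### Scaled normal derivatives. -/

/-- The `k`-th derivative in `x` of `τ φ^{(-2)}(x / τ)`, the second antiderivative of the centred
normal density with standard deviation `τ`. -/
def scaledNormal (k : ℕ) (τ x : ℝ) : ℝ :=
  τ ^ (1 - (k : ℤ)) * normalDeriv ((k : ℤ) - 2) (x / τ)

lemma hasDerivAt_scaledNormal (k : ℕ) {τ : ℝ} (hτ : 0 < τ) (x : ℝ) :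
    HasDerivAt (scaledNormal k τ) (scaledNormal (k + 1) τ x) x := by
  have h := ((hasDerivAt_normalDeriv k (x / τ)).comp x
    ((hasDerivAt_id x).div_const τ)).const_mul (τ ^ (1 - (k : ℤ)))
  refine HasDerivAt.congr_deriv h ?_
  rw [scaledNormal, show (1 - ((k + 1 : ℕ) : ℤ)) = 1 - (k : ℤ) - 1 by push_cast; ring,
    zpow_sub_one₀ hτ.ne']
  push_cast
  ring

lemma continuous_scaledNormal (k : ℕ) {τ : ℝ} (hτ : 0 < τ) : Continuous (scaledNormal k τ) :=
  continuous_iff_continuousAt.mpr fun x => (hasDerivAt_scaledNormal k hτ x).continuousAt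

lemma scaledNormal_one (τ x : ℝ) : scaledNormal 1 τ x = stdNormalCDF (x / τ) := by
  rw [← normalDeriv_neg_one]
  simp [scaledNormal]

lemma scaledNormal_add_two (n : ℕ) (τ x : ℝ) :
    scaledNormal (n + 2) τ x =
      τ ^ (1 - ((n + 2 : ℕ) : ℤ)) * iteratedDeriv n stdNormalPDF (x / τ) := by
  rw [scaledNormal, ← normalDeriv_natCast]
  congr 2
  push_cast
  ring

lemma scaledNormal_two (τ x : ℝ) : scaledNormal 2 τ x = τ⁻¹ * stdNormalPDF (x / τ) := by
  rw [scaledNormal_add_two 0]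
  simp

lemma scaledNormal_zero {τ : ℝ} (hτ : 0 < τ) (x : ℝ) :
    scaledNormal 0 τ x = τ ^ 2 * scaledNormal 2 τ x + x * scaledNormal 1 τ x := by
  rw [scaledNormal_two, scaledNormal_one, scaledNormal, show ((0 : ℕ) : ℤ) - 2 = -2 by rfl,
    normalDeriv_neg_two]
  simp
  field_simp

lemma scaledNormal_three {τ : ℝ} (hτ : 0 < τ) (x : ℝ) :
    τ ^ 2 * scaledNormal 3 τ x = - x * scaledNormal 2 τ x := by
  rw [scaledNormal_two, scaledNormal_add_two 1, iteratedDeriv_stdNormalPDF]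
  simp
  field_simp

lemma scaledNormal_two_eq_gaussianPDFReal {σ : ℝ} (hσ : 0 < σ) {v : NNReal}
    (hv : (v : ℝ) = σ ^ 2) (μ x : ℝ) :
    scaledNormal 2 σ (x - μ) = gaussianPDFReal μ v x := by
  rw [scaledNormal_two, stdNormalPDF_eq, gaussianPDFReal_def, hv]
  simp only
  rw [Real.sqrt_mul (by positivity) (σ ^ 2), Real.sqrt_sq hσ.le]
  field_simp

lemma expDecay_scaledNormal_add_two (n : ℕ) {τ : ℝ} (hτ : 0 < τ) :
    ExpDecay (scaledNormal (n + 2) τ) := by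
  obtain ⟨C, hC⟩ := exists_abs_iteratedDeriv_stdNormalPDF_le n τ
  refine ⟨τ ^ (1 - ((n + 2 : ℕ) : ℤ)) * C, fun x => ?_⟩
  rw [scaledNormal_add_two, abs_mul, abs_of_pos (a := τ ^ _) (by positivity), mul_assoc]
  refine mul_le_mul_of_nonneg_left ((hC _).trans_eq ?_) (by positivity)
  rw [abs_div, abs_of_pos hτ, mul_div_cancel₀ _ hτ.ne']

lemma exists_scaledNormal_one_le {τ : ℝ} (hτ : 0 < τ) :
    ∃ C, 0 ≤ C ∧ ∀ x, scaledNormal 1 τ x ≤ C * Real.exp x := by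
  obtain ⟨C, hC0, hC⟩ := exists_stdNormalCDF_le_exp hτ
  refine ⟨C, hC0, fun x => ?_⟩
  rw [scaledNormal_one]
  refine (hC _).trans_eq ?_
  rw [mul_div_cancel₀ _ hτ.ne']

lemma scaledNormal_one_neg (τ x : ℝ) : scaledNormal 1 τ (-x) = 1 - scaledNormal 1 τ x := by
  rw [scaledNormal_one, scaledNormal_one, neg_div, stdNormalCDF_neg]

lemma scaledNormal_one_nonneg (τ x : ℝ) : 0 ≤ scaledNormal 1 τ x := by
  rw [scaledNormal_one]
  exact stdNormalCDF_nonneg _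

lemma scaledNormal_one_le_one (τ x : ℝ) : scaledNormal 1 τ x ≤ 1 := by
  rw [scaledNormal_one]
  exact stdNormalCDF_le_one _

lemma exists_abs_scaledNormal_succ_le (k : ℕ) {τ : ℝ} (hτ : 0 < τ) :
    ∃ C, ∀ x, |scaledNormal (k + 1) τ x| ≤ C := by
  match k with
  | 0 =>
    refine ⟨1, fun x => ?_⟩
    rw [zero_add, abs_of_nonneg (scaledNormal_one_nonneg _ _)]
    exact scaledNormal_one_le_one _ _
  | n + 1 => exact (expDecay_scaledNormal_add_two n hτ).exists_abs_le

lemma linGrowth_scaledNormal (k : ℕ) {τ : ℝ} (hτ : 0 < τ) : LinGrowth (scaledNormal k τ) := by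
  match k with
  | 0 =>
    rw [funext (scaledNormal_zero hτ)]
    refine ((expDecay_scaledNormal_add_two 0 hτ).linGrowth.const_mul _).add ⟨1, fun x => ?_⟩
    rw [abs_mul, abs_of_nonneg (scaledNormal_one_nonneg τ x)]
    nlinarith [abs_nonneg x, scaledNormal_one_le_one τ x]
  | n + 1 =>
    obtain ⟨C, hC⟩ := exists_abs_scaledNormal_succ_le n hτ
    exact .of_abs_le C hC

lemma tendsto_scaledNormal_one_atBot {τ : ℝ} (hτ : 0 < τ) :
    Tendsto (scaledNormal 1 τ) atBot (𝓝 0) := by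
  obtain ⟨C, hC0, hC⟩ := exists_scaledNormal_one_le hτ
  refine squeeze_zero (scaledNormal_one_nonneg τ) hC ?_
  simpa using Real.tendsto_exp_atBot.const_mul C

lemma integrable_scaledNormal_mul (k n : ℕ) {τ ρ : ℝ} (hτ : 0 < τ) (hρ : 0 < ρ) (a b : ℝ) :
    Integrable (fun x => scaledNormal k τ (x - a) * scaledNormal (n + 2) ρ (x - b)) :=
  integrable_linGrowth_mul_expDecay ((linGrowth_scaledNormal k hτ).comp_sub a)
    ((expDecay_scaledNormal_add_two n hρ).comp_sub b)
    ((continuous_scaledNormal k hτ).comp (continuous_sub_right a))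
    ((continuous_scaledNormal _ hρ).comp (continuous_sub_right b))

/-! ### Gaussian convolution and integrals of products. -/

/-- `τ φ^{(-2)}(a / τ)` is the expectation of the positive part of `a - Z`, with `Z` centred normal
with standard deviation `τ`. -/
lemma integral_max_sub_mul_scaledNormal {τ : ℝ} (hτ : 0 < τ) (a : ℝ) :
    ∫ z, max (a - z) 0 * scaledNormal 2 τ z = scaledNormal 0 τ a := by
  have h1 : ∀ z, max (a - z) 0 * scaledNormal 2 τ z =
      (Set.Iic a).indicator (fun z => (a - z) * scaledNormal 2 τ z) z := by
    intro z
    by_cases hz : z ≤ a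
    · rw [Set.indicator_of_mem (by exact hz), max_eq_left (by linarith)]
    · rw [Set.indicator_of_notMem (by exact hz), max_eq_right (by linarith), zero_mul]
  have hc := continuous_scaledNormal 2 hτ
  have hint : Integrable (fun z => (a - z) * scaledNormal 2 τ z) :=
    integrable_linGrowth_mul_expDecay
      (by simpa using (LinGrowth.id.comp_sub a).const_mul (-1))
      (expDecay_scaledNormal_add_two 0 hτ) (by fun_prop) hc
  -- The primitive is read off from `τ² ρ' = -zρ`, where `ρ` is the `N(0, τ²)` density.
  have hd : ∀ z, HasDerivAt (fun z => a * scaledNormal 1 τ z + τ ^ 2 * scaledNormal 2 τ z)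
      ((a - z) * scaledNormal 2 τ z) z := fun z => by
    refine (((hasDerivAt_scaledNormal 1 hτ z).const_mul a).add
      ((hasDerivAt_scaledNormal 2 hτ z).const_mul (τ ^ 2))).congr_deriv ?_
    rw [scaledNormal_three hτ]
    ring
  rw [funext h1, integral_indicator measurableSet_Iic,
    integral_Iic_of_hasDerivAt_of_tendsto' (m := 0)
      (f := fun z => a * scaledNormal 1 τ z + τ ^ 2 * scaledNormal 2 τ z)
      (fun z _ => hd z) hint.integrableOn ?_, scaledNormal_zero hτ]
  · ring
  · simpa using ((tendsto_scaledNormal_one_atBot hτ).const_mul a).add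
      ((expDecay_scaledNormal_add_two 0 hτ).tendsto_atBot.const_mul (τ ^ 2))

lemma integral_mul_scaledNormal_two_eq_integral_gaussianReal {σ : ℝ} (hσ : 0 < σ) {v : NNReal}
    (hv : (v : ℝ) = σ ^ 2) (μ : ℝ) (f : ℝ → ℝ) :
    ∫ x, f x * scaledNormal 2 σ (x - μ) = ∫ x, f x ∂(gaussianReal μ v) := by
  have hv0 : v ≠ 0 := by
    rintro rfl
    exact hσ.ne' (pow_eq_zero_iff two_ne_zero |>.mp hv.symm)
  rw [integral_gaussianReal_eq_integral_smul hv0]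
  simp_rw [scaledNormal_two_eq_gaussianPDFReal hσ hv, smul_eq_mul, mul_comm]

/-- Both sides are the expectation of the positive part of `a - Y - Z` for independent centred
normals `Y`, `Z`, whose sum is normal with variance `τ² + ρ²`. -/
lemma integral_scaledNormal_zero_sub_mul {τ ρ : ℝ} (hτ : 0 < τ) (hρ : 0 < ρ) (a : ℝ) :
    ∫ y, scaledNormal 0 τ (a - y) * scaledNormal 2 ρ y = scaledNormal 0 (√(τ ^ 2 + ρ ^ 2)) a := by
  have hκ : 0 < √(τ ^ 2 + ρ ^ 2) := by positivity
  have hτv : ((τ ^ 2).toNNReal : ℝ) = τ ^ 2 := Real.coe_toNNReal _ (by positivity)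
  have hρv : ((ρ ^ 2).toNNReal : ℝ) = ρ ^ 2 := Real.coe_toNNReal _ (by positivity)
  have hκv : (((ρ ^ 2).toNNReal + (τ ^ 2).toNNReal : NNReal) : ℝ) = (√(τ ^ 2 + ρ ^ 2)) ^ 2 := by
    rw [NNReal.coe_add, hτv, hρv, Real.sq_sqrt (by positivity), add_comm]
  have hmax : ∀ {σ : ℝ} (_ : 0 < σ) {v : NNReal} (_ : (v : ℝ) = σ ^ 2) (b : ℝ),
      ∫ z, max (b - z) 0 ∂(gaussianReal 0 v) = scaledNormal 0 σ b := by
    intro σ hσ v hv b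
    rw [← integral_mul_scaledNormal_two_eq_integral_gaussianReal hσ hv]
    simp_rw [sub_zero]
    exact integral_max_sub_mul_scaledNormal hσ b
  have hint : Integrable (fun u => max (a - u) 0)
      (gaussianReal 0 (ρ ^ 2).toNNReal ∗ gaussianReal 0 (τ ^ 2).toNNReal) := by
    rw [gaussianReal_conv_gaussianReal]
    have hid : Integrable (fun u : ℝ => u)
        (gaussianReal (0 + 0) ((ρ ^ 2).toNNReal + (τ ^ 2).toNNReal)) :=
      (memLp_id_gaussianReal 1).integrable le_rfl
    exact ((integrable_const a).sub hid).pos_part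
  have h := integral_conv hint
  rw [gaussianReal_conv_gaussianReal, zero_add, hmax hκ hκv] at h
  rw [h]
  simp_rw [← sub_sub, hmax hτ hτv]
  rw [← integral_mul_scaledNormal_two_eq_integral_gaussianReal hρ hρv]
  simp

/-- Convolution with a centred normal density adds up the variances. -/
lemma integral_scaledNormal_sub_mul (k : ℕ) {τ ρ : ℝ} (hτ : 0 < τ) (hρ : 0 < ρ) (a : ℝ) :
    ∫ y, scaledNormal k τ (a - y) * scaledNormal 2 ρ y = scaledNormal k (√(τ ^ 2 + ρ ^ 2)) a := by
  have hκ : 0 < √(τ ^ 2 + ρ ^ 2) := by positivity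
  induction k generalizing a with
  | zero => exact integral_scaledNormal_zero_sub_mul hτ hρ a
  | succ k ih =>
    obtain ⟨C, hC⟩ := exists_abs_scaledNormal_succ_le k hτ
    have hc2 := continuous_scaledNormal 2 hρ
    have hck := continuous_scaledNormal k hτ
    have hck1 := continuous_scaledNormal (k + 1) hτ
    -- The identity of order `k` is differentiated in `a`. Order `k + 1` is bounded, so a multiple
    -- of the density dominates the differentiated integrand.
    have hd := hasDerivAt_integral_of_dominated_loc_of_deriv_le (μ := volume) (s := Set.univ)
      (x₀ := a) (F := fun x y => scaledNormal k τ (x - y) * scaledNormal 2 ρ y)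
      (F' := fun x y => scaledNormal (k + 1) τ (x - y) * scaledNormal 2 ρ y)
      (bound := fun y => C * |scaledNormal 2 ρ y|) univ_mem
      (Eventually.of_forall fun x => by
        refine Continuous.aestronglyMeasurable ?_
        fun_prop)
      ?_ ?_ ?_ ?_ ?_
    · rw [funext ih] at hd
      exact hd.2.unique (hasDerivAt_scaledNormal k hκ a)
    · refine integrable_linGrowth_mul_expDecay ?_ (expDecay_scaledNormal_add_two 0 hρ)
        (by fun_prop) hc2
      obtain ⟨D, hD0, hD⟩ := (linGrowth_scaledNormal k hτ).exists_nonneg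
      refine ⟨D * (1 + |a|), fun x => (hD _).trans ?_⟩
      rw [mul_assoc]
      refine mul_le_mul_of_nonneg_left ?_ hD0
      nlinarith [abs_sub a x, mul_nonneg (abs_nonneg a) (abs_nonneg x)]
    · refine Continuous.aestronglyMeasurable ?_
      fun_prop
    · refine ae_of_all _ fun y x _ => ?_
      rw [norm_mul]
      exact mul_le_mul_of_nonneg_right (hC _) (norm_nonneg _)
    · exact (((expDecay_scaledNormal_add_two 0 hρ).integrable hc2).abs).const_mul C
    · refine ae_of_all _ fun y x _ => ?_
      exact ((hasDerivAt_scaledNormal k hτ (x - y)).comp_sub_const x y).mul_const _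

lemma scaledNormal_two_neg (τ x : ℝ) : scaledNormal 2 τ (-x) = scaledNormal 2 τ x := by
  rw [scaledNormal_two, scaledNormal_two, neg_div, stdNormalPDF_neg]

/-- Evenness of the density turns the case `n = 0` into a convolution. Each further derivative moves
to the other factor by parts, at the cost of a sign. -/
lemma integral_scaledNormal_mul (k n : ℕ) {τ ρ : ℝ} (hτ : 0 < τ) (hρ : 0 < ρ) (a b : ℝ) :
    ∫ x, scaledNormal k τ (x - a) * scaledNormal (n + 2) ρ (x - b) =
      (-1) ^ n * scaledNormal (k + n) (√(τ ^ 2 + ρ ^ 2)) (b - a) := by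
  induction n generalizing k with
  | zero =>
    simp only [zero_add, pow_zero, one_mul, add_zero]
    rw [← integral_scaledNormal_sub_mul k hτ hρ, ← integral_sub_left_eq_self _ volume b]
    congr! 3 with y
    · ring_nf
    · rw [← scaledNormal_two_neg]
      ring_nf
  | succ n ih =>
    have h := integral_mul_deriv_eq_deriv_mul_of_integrable
      (u := fun x => scaledNormal k τ (x - a)) (u' := fun x => scaledNormal (k + 1) τ (x - a))
      (v := fun x => scaledNormal (n + 2) ρ (x - b))
      (v' := fun x => scaledNormal (n + 2 + 1) ρ (x - b))
      (fun x _ => (hasDerivAt_scaledNormal k hτ (x - a)).comp_sub_const x a)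
      (fun x _ => (hasDerivAt_scaledNormal (n + 2) hρ (x - b)).comp_sub_const x b)
      (integrable_scaledNormal_mul k (n + 1) hτ hρ a b)
      (integrable_scaledNormal_mul (k + 1) n hτ hρ a b)
      (integrable_scaledNormal_mul k n hτ hρ a b)
    rw [show n + 1 + 2 = n + 2 + 1 by ring, h, ih (k + 1), show k + 1 + n = k + (n + 1) by ring]
    ring

/-! ### One-sided exponential decay. -/

lemma integrable_of_abs_le_mul_exp_neg_abs {f : ℝ → ℝ} (hc : Continuous f) {C : ℝ}
    (hf : ∀ x, |f x| ≤ C * ((1 + |x|) * Real.exp (-|x|))) : Integrable f := by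
  have h : Integrable (fun x : ℝ => (1 + |x|) * Real.exp (-|x|)) :=
    integrable_linGrowth_mul_expDecay ⟨1, fun x => by rw [abs_of_nonneg (by positivity), one_mul]⟩
      ⟨1, fun x => by rw [Real.abs_exp, one_mul]⟩ (by fun_prop) (by fun_prop)
  exact (h.const_mul C).mono' hc.aestronglyMeasurable (ae_of_all _ hf)

lemma ExpDecay.exists_abs_le_exp {f : ℝ → ℝ} (hf : ExpDecay f) :
    ∃ C, 0 ≤ C ∧ (∀ x, |f x| ≤ C * Real.exp x) ∧ ∀ x, |f x| ≤ C * Real.exp (-x) := by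
  obtain ⟨C, hC0, hC⟩ := hf.exists_nonneg
  refine ⟨C, hC0, fun x => (hC x).trans ?_, fun x => (hC x).trans ?_⟩
  · exact mul_le_mul_of_nonneg_left (Real.exp_le_exp.mpr (neg_abs_le x)) hC0
  · exact mul_le_mul_of_nonneg_left (Real.exp_le_exp.mpr (neg_le_neg (le_abs_self x))) hC0

/-- Exponential decay at `-∞`. -/
def LeftDecay (f : ℝ → ℝ) : Prop := ∃ C, ∀ x, |f x| ≤ C * Real.exp x

/-- Exponential decay at `+∞`. -/
def RightDecay (f : ℝ → ℝ) : Prop := ∃ C, ∀ x, |f x| ≤ C * Real.exp (-x)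

lemma LeftDecay.sum_mul {ι : Type*} {s : Finset ι} (c : ι → ℝ) {f : ι → ℝ → ℝ}
    (hf : ∀ i ∈ s, LeftDecay (f i)) : LeftDecay (fun x => ∑ i ∈ s, c i * f i x) := by
  choose! C hC using hf
  refine ⟨∑ i ∈ s, |c i| * C i, fun x => (Finset.abs_sum_le_sum_abs _ _).trans ?_⟩
  rw [Finset.sum_mul]
  refine Finset.sum_le_sum fun i hi => ?_
  rw [abs_mul, mul_assoc]
  exact mul_le_mul_of_nonneg_left (hC i hi x) (abs_nonneg _)

lemma LeftDecay.comp_sub {f : ℝ → ℝ} (hf : LeftDecay f) (a : ℝ) :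
    LeftDecay (fun x => f (x - a)) := by
  obtain ⟨C, hC⟩ := hf
  refine ⟨C * Real.exp (-a), fun x => (hC _).trans_eq ?_⟩
  rw [mul_assoc, ← Real.exp_add]
  ring_nf

lemma RightDecay.sum_mul {ι : Type*} {s : Finset ι} (c : ι → ℝ) {f : ι → ℝ → ℝ}
    (hf : ∀ i ∈ s, RightDecay (f i)) : RightDecay (fun x => ∑ i ∈ s, c i * f i x) := by
  choose! C hC using hf
  refine ⟨∑ i ∈ s, |c i| * C i, fun x => (Finset.abs_sum_le_sum_abs _ _).trans ?_⟩
  rw [Finset.sum_mul]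
  refine Finset.sum_le_sum fun i hi => ?_
  rw [abs_mul, mul_assoc]
  exact mul_le_mul_of_nonneg_left (hC i hi x) (abs_nonneg _)

lemma RightDecay.comp_sub {f : ℝ → ℝ} (hf : RightDecay f) (a : ℝ) :
    RightDecay (fun x => f (x - a)) := by
  obtain ⟨C, hC⟩ := hf
  refine ⟨C * Real.exp a, fun x => (hC _).trans_eq ?_⟩
  rw [mul_assoc, ← Real.exp_add]
  ring_nf

lemma ExpDecay.leftDecay {f : ℝ → ℝ} (hf : ExpDecay f) : LeftDecay f :=
  let ⟨C, _, hC, _⟩ := hf.exists_abs_le_exp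
  ⟨C, hC⟩

lemma ExpDecay.rightDecay {f : ℝ → ℝ} (hf : ExpDecay f) : RightDecay f :=
  let ⟨C, _, _, hC⟩ := hf.exists_abs_le_exp
  ⟨C, hC⟩

/-- The delicate term is `x Φ(x/τ)` for `x ≤ 0`: there `|x| ≤ e^{-x}`, and the tail bound at rate
`2τ` supplies `e^{2x}`. -/
lemma leftDecay_scaledNormal_zero {τ : ℝ} (hτ : 0 < τ) : LeftDecay (scaledNormal 0 τ) := by
  obtain ⟨C, hC0, hC⟩ := exists_stdNormalCDF_le_exp (a := 2 * τ) (by positivity)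
  obtain ⟨D, hD⟩ := (expDecay_scaledNormal_add_two 0 hτ).leftDecay
  refine ⟨τ ^ 2 * D + (C + 1), fun x => ?_⟩
  have hx : |x * scaledNormal 1 τ x| ≤ (C + 1) * Real.exp x := by
    rw [abs_mul, abs_of_nonneg (scaledNormal_one_nonneg τ x)]
    rcases le_total 0 x with h | h
    · calc |x| * scaledNormal 1 τ x ≤ |x| * 1 := by
            gcongr
            exact scaledNormal_one_le_one τ x
        _ ≤ Real.exp x := by
            rw [mul_one, abs_of_nonneg h]
            linarith [Real.add_one_le_exp x]
        _ ≤ _ := le_mul_of_one_le_left (Real.exp_pos x).le (by linarith)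
    · calc |x| * scaledNormal 1 τ x ≤ Real.exp (-x) * (C * Real.exp (2 * x)) := by
            rw [scaledNormal_one, abs_of_nonpos h]
            refine mul_le_mul (by linarith [Real.add_one_le_exp (-x)]) ((hC _).trans_eq ?_)
              (stdNormalCDF_nonneg _) (Real.exp_pos _).le
            congr 2
            field_simp
        _ = C * Real.exp x := by
            rw [mul_left_comm, ← Real.exp_add]
            ring_nf
        _ ≤ _ := by
            gcongr
            linarith
  rw [scaledNormal_zero hτ, add_mul]
  refine (abs_add_le _ _).trans (add_le_add ?_ hx)
  rw [abs_mul, abs_of_nonneg (by positivity), mul_assoc]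
  exact mul_le_mul_of_nonneg_left (hD x) (by positivity)

lemma leftDecay_scaledNormal (k : ℕ) {τ : ℝ} (hτ : 0 < τ) : LeftDecay (scaledNormal k τ) := by
  match k with
  | 0 => exact leftDecay_scaledNormal_zero hτ
  | 1 =>
    obtain ⟨C, _, hC⟩ := exists_scaledNormal_one_le hτ
    refine ⟨C, fun x => ?_⟩
    rw [abs_of_nonneg (scaledNormal_one_nonneg τ x)]
    exact hC x
  | n + 2 => exact (expDecay_scaledNormal_add_two n hτ).leftDecay

/-- The `if` is the limit at `+∞`: only `Φ` itself has a nonzero one. For `e = 0` the reflection `1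
- Φ(x) = Φ(-x)` reduces the claim to the left tail; for `e > 0` the function decays on both sides.
-/
lemma rightDecay_scaledNormal_sub (e : ℕ) {τ : ℝ} (hτ : 0 < τ) :
    RightDecay (fun x => (if e = 0 then 1 else 0) - scaledNormal (2 * e + 1) τ x) := by
  match e with
  | 0 =>
    obtain ⟨C, _, hC⟩ := exists_scaledNormal_one_le hτ
    refine ⟨C, fun x => ?_⟩
    simp only [if_true, mul_zero, zero_add]
    rw [← scaledNormal_one_neg, abs_of_nonneg (scaledNormal_one_nonneg τ _)]
    exact hC _
  | e + 1 =>
    obtain ⟨C, hC⟩ := (expDecay_scaledNormal_add_two (2 * e + 1) hτ).rightDecay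
    refine ⟨C, fun x => ?_⟩
    simp only [add_eq_zero, one_ne_zero, and_false, if_false, zero_sub, abs_neg]
    exact hC x

/-! ### Linear combinations `M` of normal derivatives and the integral of `M (κ - M)`. -/

section NormalCombination

variable {ι : Type*} (S : Finset ι) (c : ι → ℝ) (e : ι → ℕ) (τ μ : ι → ℝ)

/-- A linear combination of even derivatives of normal distribution functions, differentiated
`d - 1` further times. -/
def normalComb (d : ℕ) (x : ℝ) : ℝ := ∑ k ∈ S, c k * scaledNormal (2 * e k + d) (τ k) (x - μ k)

/-- The limit at `+∞` of a linear combination of even derivatives of normal distribution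
functions. -/
def normalCombMass : ℝ := ∑ k ∈ S, c k * if e k = 0 then 1 else 0

variable {S c e τ μ}

lemma hasDerivAt_normalComb (hτ : ∀ k ∈ S, 0 < τ k) (d : ℕ) (x : ℝ) :
    HasDerivAt (normalComb S c e τ μ d) (normalComb S c e τ μ (d + 1) x) x :=
  HasDerivAt.fun_sum fun k hk =>
    ((hasDerivAt_scaledNormal (2 * e k + d) (hτ k hk) (x - μ k)).comp_sub_const x (μ k)).const_mul _

lemma continuous_normalComb (hτ : ∀ k ∈ S, 0 < τ k) (d : ℕ) :
    Continuous (normalComb S c e τ μ d) :=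
  continuous_iff_continuousAt.mpr fun x => (hasDerivAt_normalComb hτ d x).continuousAt

lemma linGrowth_normalComb (hτ : ∀ k ∈ S, 0 < τ k) (d : ℕ) :
    LinGrowth (normalComb S c e τ μ d) :=
  .sum fun k hk => ((linGrowth_scaledNormal _ (hτ k hk)).comp_sub (μ k)).const_mul _

lemma expDecay_normalComb_add_two (hτ : ∀ k ∈ S, 0 < τ k) (d : ℕ) :
    ExpDecay (normalComb S c e τ μ (d + 2)) :=
  .sum fun k hk => ((expDecay_scaledNormal_add_two _ (hτ k hk)).comp_sub (μ k)).const_mul _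

lemma exists_abs_normalComb_succ_le (hτ : ∀ k ∈ S, 0 < τ k) (d : ℕ) :
    ∃ C, ∀ x, |normalComb S c e τ μ (d + 1) x| ≤ C := by
  have h : ∀ k ∈ S, ∃ C, ∀ x, |scaledNormal (2 * e k + d + 1) (τ k) x| ≤ C :=
    fun k hk => exists_abs_scaledNormal_succ_le _ (hτ k hk)
  choose! C hC using h
  refine ⟨∑ k ∈ S, |c k| * C k, fun x => (Finset.abs_sum_le_sum_abs _ _).trans ?_⟩
  refine Finset.sum_le_sum fun k hk => ?_
  rw [abs_mul]
  exact mul_le_mul_of_nonneg_left (hC k hk _) (abs_nonneg _)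

lemma leftDecay_normalComb (hτ : ∀ k ∈ S, 0 < τ k) (d : ℕ) :
    LeftDecay (normalComb S c e τ μ d) :=
  LeftDecay.sum_mul c fun k hk => (leftDecay_scaledNormal _ (hτ k hk)).comp_sub (μ k)

lemma rightDecay_normalCombMass_sub (hτ : ∀ k ∈ S, 0 < τ k) :
    RightDecay (fun x => normalCombMass S c e - normalComb S c e τ μ 1 x) := by
  simp_rw [normalCombMass, normalComb, ← Finset.sum_sub_distrib, ← mul_sub]
  exact RightDecay.sum_mul c fun k hk => (rightDecay_scaledNormal_sub (e k) (hτ k hk)).comp_sub (μ k)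

/-- On each half-line one factor decays exponentially, while the other is bounded or grows at most
linearly. -/
lemma LeftDecay.exists_abs_mul_le {f g : ℝ → ℝ} (hf : LeftDecay f) (hf' : LinGrowth f)
    (hg : RightDecay g) (hg' : ∃ C, ∀ x, |g x| ≤ C) :
    ∃ C, ∀ x, |f x * g x| ≤ C * ((1 + |x|) * Real.exp (-|x|)) := by
  obtain ⟨A, hA⟩ := hf
  obtain ⟨B, hB⟩ := hf'
  obtain ⟨C, hC⟩ := hg
  obtain ⟨D, hD⟩ := hg'
  have hA0 : 0 ≤ A := by simpa using (abs_nonneg _).trans (hA 0)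
  have hB0 : 0 ≤ B := by simpa using (abs_nonneg _).trans (hB 0)
  have hC0 : 0 ≤ C := by simpa using (abs_nonneg _).trans (hC 0)
  have hD0 : 0 ≤ D := (abs_nonneg _).trans (hD 0)
  refine ⟨B * C + A * D, fun x => ?_⟩
  rw [abs_mul]
  rcases le_total 0 x with h | h
  · calc |f x| * |g x| ≤ (B * (1 + |x|)) * (C * Real.exp (-x)) :=
          mul_le_mul (hB x) (hC x) (abs_nonneg _) (by positivity)
      _ = B * C * ((1 + |x|) * Real.exp (-|x|)) := by
          rw [abs_of_nonneg h]
          ring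
      _ ≤ _ := by
          gcongr
          nlinarith
  · calc |f x| * |g x| ≤ (A * Real.exp x) * D :=
          mul_le_mul (hA x) (hD x) (abs_nonneg _) (by positivity)
      _ = A * D * (1 * Real.exp (-|x|)) := by
          rw [abs_of_nonpos h, neg_neg]
          ring
      _ ≤ A * D * ((1 + |x|) * Real.exp (-|x|)) := by
          gcongr
          linarith [abs_nonneg x]
      _ ≤ _ := by
          gcongr
          nlinarith

lemma exists_abs_normalCombMass_sub_le (hτ : ∀ k ∈ S, 0 < τ k) :
    ∃ C, ∀ x, |normalCombMass S c e - normalComb S c e τ μ 1 x| ≤ C := by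
  obtain ⟨C, hC⟩ := exists_abs_normalComb_succ_le (c := c) (e := e) (μ := μ) hτ 0
  exact ⟨|normalCombMass S c e| + C, fun x =>
    (abs_sub _ _).trans (add_le_add_right (hC x) _)⟩

/-- The case `d = 0` makes the boundary terms vanish in the integration by parts below. The
antiderivative may grow linearly at `+∞`, where the second factor compensates. -/
lemma integrable_normalComb_mul_mass_sub (hτ : ∀ k ∈ S, 0 < τ k) (d : ℕ) :
    Integrable (fun x => normalComb S c e τ μ d x *
      (normalCombMass S c e - normalComb S c e τ μ 1 x)) := by
  obtain ⟨C, hC⟩ := (leftDecay_normalComb (c := c) (e := e) (μ := μ) hτ d).exists_abs_mul_le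
    (linGrowth_normalComb hτ d) (rightDecay_normalCombMass_sub (c := c) (e := e) (μ := μ) hτ)
    (exists_abs_normalCombMass_sub_le hτ)
  exact integrable_of_abs_le_mul_exp_neg_abs ((continuous_normalComb hτ d).mul
    (continuous_const.sub (continuous_normalComb hτ 1))) hC

/-- For `M` a linear combination of even derivatives of normal distribution functions with limit
`κ` at `+∞`, the integral of `M (κ - M)` is a double sum of normal derivatives. -/
lemma integral_normalComb_mul_mass_sub (hτ : ∀ k ∈ S, 0 < τ k) :
    ∫ x, normalComb S c e τ μ 1 x * (normalCombMass S c e - normalComb S c e τ μ 1 x) =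
      ∑ k ∈ S, ∑ l ∈ S, c k * c l *
        scaledNormal (2 * e k + 2 * e l) (√(τ k ^ 2 + τ l ^ 2)) (μ l - μ k) := by
  set M := normalComb S c e τ μ with hM
  set κ := normalCombMass S c e
  have hI : ∀ d, Integrable (fun x => M d x * (M 1 x - κ)) := fun d =>
    (integrable_normalComb_mul_mass_sub hτ d).neg.congr (ae_of_all _ fun x => by
      simp only [Pi.neg_apply]
      ring)
  -- The antiderivative of `M'` is taken to be `M - κ`, so that it vanishes at `+∞`; at `-∞` the
  -- factor `M 0` vanishes.
  have h := integral_mul_deriv_eq_deriv_mul_of_integrable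
    (u := M 0) (u' := M 1) (v := fun x => M 1 x - κ) (v' := M 2)
    (fun x _ => hasDerivAt_normalComb hτ 0 x)
    (fun x _ => (hasDerivAt_normalComb hτ 1 x).sub_const κ)
    (integrable_linGrowth_mul_expDecay (linGrowth_normalComb hτ 0)
      (expDecay_normalComb_add_two hτ 0) (continuous_normalComb hτ 0) (continuous_normalComb hτ 2))
    (hI 1) (hI 0)
  rw [← integral_neg] at h
  have h' : ∫ x, M 1 x * (κ - M 1 x) = ∫ x, M 0 x * M 2 x := by
    rw [h]
    congr 1 with x
    ring
  have hk : ∀ k ∈ S, ∀ l ∈ S, Integrable (fun x =>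
      c k * scaledNormal (2 * e k + 0) (τ k) (x - μ k) *
        (c l * scaledNormal (2 * e l + 2) (τ l) (x - μ l))) := fun k hk l hl =>
    ((integrable_scaledNormal_mul (2 * e k + 0) (2 * e l) (hτ k hk) (hτ l hl) (μ k)
      (μ l)).const_mul (c k * c l)).congr (ae_of_all _ fun x => by ring)
  rw [h']
  simp only [hM, normalComb, Finset.sum_mul_sum]
  rw [integral_finsetSum _ fun k hk' => integrable_finsetSum _ fun l hl => hk k hk' l hl]
  refine Finset.sum_congr rfl fun k hk' => ?_
  rw [integral_finsetSum _ fun l hl => hk k hk' l hl]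
  refine Finset.sum_congr rfl fun l hl => ?_
  -- The number of derivatives moved across is even, so no sign survives.
  have h2 := integral_scaledNormal_mul (2 * e k) (2 * e l) (hτ k hk') (hτ l hl) (μ k) (μ l)
  rw [pow_mul, neg_one_sq, one_pow, one_mul] at h2
  rw [← h2, ← integral_const_mul]
  congr 1 with x
  ring_nf

end NormalCombination

/-! ### The Gaussian-based kernels and `ψ₁`. -/

/-- The coefficients of the Gaussian-based kernels in terms of the even derivatives of `φ`. -/
def kernelCoeff (s : ℕ) : ℝ := (-1 : ℝ) ^ s / (2 ^ s * (s ! : ℝ))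

lemma kernelCoeff_mul (s t : ℕ) :
    kernelCoeff s * kernelCoeff t =
      (-1 : ℝ) ^ (s + t) / (2 ^ (s + t) * (s ! : ℝ) * (t ! : ℝ)) := by
  rw [kernelCoeff, kernelCoeff, div_mul_div_comm, pow_add, pow_add]
  ring_nf

/-- The Gaussian-based kernel as a combination of normal derivatives, differentiated `d - 1` times
from its distribution function. -/
def kernelComb (r d : ℕ) (x : ℝ) : ℝ :=
  normalComb (Finset.range r) kernelCoeff (fun s => s) (fun _ => 1) (fun _ => 0) d x

lemma gaussKernel_eq_kernelComb (r : ℕ) : gaussKernel r = kernelComb r 2 := by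
  ext x
  refine Finset.sum_congr rfl fun s _ => ?_
  rw [scaledNormal, one_zpow, one_mul, sub_zero, div_one, kernelCoeff]
  congr 2
  push_cast
  ring

lemma hasDerivAt_kernelComb (r d : ℕ) (x : ℝ) :
    HasDerivAt (kernelComb r d) (kernelComb r (d + 1) x) x :=
  hasDerivAt_normalComb (fun _ _ => one_pos) d x

lemma continuous_kernelComb (r d : ℕ) : Continuous (kernelComb r d) :=
  continuous_normalComb (fun _ _ => one_pos) d

lemma expDecay_kernelComb_two (r : ℕ) : ExpDecay (kernelComb r 2) :=
  expDecay_normalComb_add_two (fun _ _ => one_pos) 0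

lemma exists_abs_kernelComb_one_le (r : ℕ) : ∃ C, ∀ x, |kernelComb r 1 x| ≤ C :=
  exists_abs_normalComb_succ_le (fun _ _ => one_pos) 0

lemma LeftDecay.tendsto_atBot {f : ℝ → ℝ} (hf : LeftDecay f) : Tendsto f atBot (𝓝 0) := by
  obtain ⟨C, hC⟩ := hf
  refine squeeze_zero_norm hC ?_
  simpa using Real.tendsto_exp_atBot.const_mul C

lemma gaussKernelCDF_eq_kernelComb (r : ℕ) : gaussKernelCDF r = kernelComb r 1 := by
  ext x
  rw [gaussKernelCDF, integratedKernel, gaussKernel_eq_kernelComb,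
    integral_Iic_of_hasDerivAt_of_tendsto' (fun y _ => hasDerivAt_kernelComb r 1 y)
      ((expDecay_kernelComb_two r).integrable (continuous_kernelComb r 2)).integrableOn
      (leftDecay_normalComb (fun _ _ => one_pos) 1).tendsto_atBot, sub_zero]

/-- Only `s = 0` contributes, since the proper derivatives of `Φ` vanish at `+∞`. This is where `r ≥
1` matters. -/
lemma sum_kernelCoeff_mass {r : ℕ} (hr : 1 ≤ r) :
    normalCombMass (Finset.range r) kernelCoeff (fun s : ℕ => s) = 1 := by
  simp [normalCombMass, kernelCoeff, Finset.sum_ite_eq', Nat.pos_iff_ne_zero.mp hr]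

lemma kernelComb_two_neg (r : ℕ) (x : ℝ) : kernelComb r 2 (-x) = kernelComb r 2 x := by
  simp only [kernelComb, normalComb]
  refine Finset.sum_congr rfl fun s _ => ?_
  congr 1
  rw [scaledNormal_add_two, scaledNormal_add_two, sub_zero, sub_zero, neg_div]
  have h := iteratedDeriv_comp_neg (2 * s) stdNormalPDF (x / 1)
  simp only [stdNormalPDF_neg, pow_mul, neg_one_sq, one_pow, one_smul] at h
  rw [← h]

/-- With both factors bounded there is no linear loss, so the product stays integrable after
multiplication by `x`, as needed for `ψ₁`. -/
lemma LeftDecay.mul_rightDecay {f g : ℝ → ℝ} (hf : LeftDecay f) (hf' : ∃ C, ∀ x, |f x| ≤ C)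
    (hg : RightDecay g) (hg' : ∃ C, ∀ x, |g x| ≤ C) : ExpDecay (fun x => f x * g x) := by
  obtain ⟨A, hA⟩ := hf
  obtain ⟨B, hB⟩ := hf'
  obtain ⟨C, hC⟩ := hg
  obtain ⟨D, hD⟩ := hg'
  have hA0 : 0 ≤ A := by simpa using (abs_nonneg _).trans (hA 0)
  have hB0 : 0 ≤ B := (abs_nonneg _).trans (hB 0)
  have hC0 : 0 ≤ C := by simpa using (abs_nonneg _).trans (hC 0)
  have hD0 : 0 ≤ D := (abs_nonneg _).trans (hD 0)
  refine ⟨B * C + A * D, fun x => ?_⟩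
  rw [abs_mul]
  have hBC := mul_nonneg (mul_nonneg hB0 hC0) (Real.exp_pos (-|x|)).le
  have hAD := mul_nonneg (mul_nonneg hA0 hD0) (Real.exp_pos (-|x|)).le
  rcases le_total 0 x with h | h
  · have h1 := mul_le_mul (hB x) (hC x) (abs_nonneg _) hB0
    rw [abs_of_nonneg h] at *
    linarith
  · have h1 := mul_le_mul (hA x) (hD x) (abs_nonneg _) (by positivity)
    rw [abs_of_nonpos h, neg_neg] at *
    linarith

lemma expDecay_kernelComb_mul_one_sub {r : ℕ} (hr : 1 ≤ r) :
    ExpDecay (fun x => kernelComb r 1 x * (1 - kernelComb r 1 x)) := by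
  have h1 := rightDecay_normalCombMass_sub (S := Finset.range r) (c := kernelCoeff)
    (e := fun s => s) (τ := fun _ => 1) (μ := fun _ => 0) (fun _ _ => one_pos)
  have h2 := exists_abs_normalCombMass_sub_le (S := Finset.range r) (c := kernelCoeff)
    (e := fun s => s) (τ := fun _ => 1) (μ := fun _ => 0) (fun _ _ => one_pos)
  rw [sum_kernelCoeff_mass hr] at h1 h2
  exact (leftDecay_normalComb (fun _ _ => one_pos) 1).mul_rightDecay
    (exists_abs_kernelComb_one_le r) h1 h2

lemma integrable_kernelComb_mul_one_sub {r : ℕ} (hr : 1 ≤ r) :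
    Integrable (fun x => kernelComb r 1 x * (1 - kernelComb r 1 x)) :=
  (expDecay_kernelComb_mul_one_sub hr).integrable
    ((continuous_kernelComb r 1).mul (continuous_const.sub (continuous_kernelComb r 1)))

lemma integral_kernelComb_mul_one_sub {r : ℕ} (hr : 1 ≤ r) :
    ∫ x, kernelComb r 1 x * (1 - kernelComb r 1 x) =
      ∑ s ∈ Finset.range r, ∑ t ∈ Finset.range r, kernelCoeff s * kernelCoeff t *
        scaledNormal (2 * s + 2 * t) (√2) 0 := by
  have h := integral_normalComb_mul_mass_sub (S := Finset.range r) (c := kernelCoeff)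
    (e := fun s => s) (τ := fun _ => 1) (μ := fun _ => 0) (fun _ _ => one_pos)
  rw [sum_kernelCoeff_mass hr] at h
  norm_num at h
  exact h

lemma integrable_mul_kernelComb (r : ℕ) :
    Integrable (fun x => x * kernelComb r 1 x * kernelComb r 2 x) := by
  obtain ⟨C, hC⟩ := exists_abs_kernelComb_one_le r
  have hC0 : 0 ≤ C := (abs_nonneg _).trans (hC 0)
  refine integrable_linGrowth_mul_expDecay ⟨C, fun x => ?_⟩ (expDecay_kernelComb_two r)
    (continuous_id.mul (continuous_kernelComb r 1)) (continuous_kernelComb r 2)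
  rw [abs_mul, mul_comm]
  exact mul_le_mul (hC x) (by linarith) (abs_nonneg _) hC0

/-- Integration by parts with `u = x` and `v = G (1 - G)`, so `v' = g - 2Gg`. The term `∫ x g`
vanishes because `g` is even. -/
lemma psiOne_gaussKernel {r : ℕ} (hr : 1 ≤ r) :
    psiOne (gaussKernel r) = ∫ x, kernelComb r 1 x * (1 - kernelComb r 1 x) := by
  have hG : integratedKernel (gaussKernel r) = kernelComb r 1 := gaussKernelCDF_eq_kernelComb r
  rw [psiOne, hG, gaussKernel_eq_kernelComb]
  set G := kernelComb r 1
  set g := kernelComb r 2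
  have hd : ∀ x, HasDerivAt G (g x) x := hasDerivAt_kernelComb r 1
  have hxg : Integrable (fun x => x * g x) :=
    integrable_linGrowth_mul_expDecay LinGrowth.id (expDecay_kernelComb_two r) continuous_id
      (continuous_kernelComb r 2)
  have hodd : ∫ x, x * g x = 0 := by
    have h := integral_neg_eq_self (fun x => x * g x) volume
    simp only [g, kernelComb_two_neg, neg_mul, integral_neg] at h
    simp only [g]
    linarith
  have hxGg : Integrable (fun x => x * G x * g x) := integrable_mul_kernelComb r
  have hGG := integrable_kernelComb_mul_one_sub hr
  have hxGG : Integrable (fun x => x * (G x * (1 - G x))) :=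
    integrable_linGrowth_mul_expDecay LinGrowth.id (expDecay_kernelComb_mul_one_sub hr)
      continuous_id
      ((continuous_kernelComb r 1).mul (continuous_const.sub (continuous_kernelComb r 1)))
  have h := integral_mul_deriv_eq_deriv_mul_of_integrable
    (u := fun x => x) (u' := fun _ => 1) (v := fun x => G x * (1 - G x))
    (v' := fun x => g x - 2 * (G x * g x))
    (fun x _ => hasDerivAt_id x)
    (fun x _ => ((hd x).mul ((hd x).const_sub 1)).congr_deriv (by ring))
    ((hxg.sub (hxGg.const_mul 2)).congr (ae_of_all _ fun x => by
      simp only [Pi.mul_apply, Pi.sub_apply]; ring))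
    (hGG.congr (ae_of_all _ fun x => by simp [G]))
    hxGG
  have h2 : ∫ x, x * (g x - 2 * (G x * g x)) = - (2 * ∫ x, x * G x * g x) := by
    rw [← integral_const_mul, ← zero_sub, ← hodd, ← integral_sub hxg (hxGg.const_mul 2)]
    congr 1 with x
    ring
  rw [h2] at h
  simpa using h

/-! ### The constant `C(r)` as a sum of odd factorials. -/

lemma oddFactorial_two_mul_sub_two_zero : oddFactorial (2 * ((0 : ℕ) : ℤ) - 2) = -1 := by
  rw [oddFactorial, if_neg (by decide), if_neg (by decide)]
  norm_num

lemma prod_Icc_two_mul_sub_one (n : ℕ) :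
    ∏ i ∈ Finset.Icc 1 n, (2 * (i : ℝ) - 1) = ((2 * n - 1)‼ : ℕ) := by
  induction n with
  -- Truncated subtraction makes the right side `0‼ = 1`, the empty product.
  | zero => simp
  | succ n ih =>
    rw [Finset.prod_Icc_succ_top (by omega), ih, show 2 * (n + 1) - 1 = 2 * n + 1 by omega,
      Nat.doubleFactorial_add_one]
    push_cast
    ring

lemma oddFactorial_two_mul_succ_sub_two (n : ℕ) :
    oddFactorial (2 * ((n + 1 : ℕ) : ℤ) - 2) = ((2 * n - 1)‼ : ℕ) := by
  rw [show 2 * ((n + 1 : ℕ) : ℤ) - 2 = ((2 * n : ℕ) : ℤ) by push_cast; ring, oddFactorial,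
    if_neg (by simp), if_pos (by positivity), Int.natAbs_natCast,
    Nat.mul_div_cancel_left _ two_pos, prod_Icc_two_mul_sub_one]

/-- For `k ≥ 1` this is the constant term of an even Hermite polynomial. For `k = 0` the value is
`√2 φ(0) = 1/√π`, which matches the convention `OF(-2) = -1`. -/
lemma scaledNormal_sqrt_two_zero (k : ℕ) :
    scaledNormal (2 * k) (√2) 0 =
      -((-1) ^ k * oddFactorial (2 * (k : ℤ) - 2) / (2 ^ k * √Real.pi)) := by
  have h2 : √2 ^ 2 = 2 := Real.sq_sqrt zero_le_two
  have hs : (√2 : ℝ) ≠ 0 := by positivity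
  have hφ : stdNormalPDF 0 = (√2 * √Real.pi)⁻¹ := by
    rw [stdNormalPDF_eq]
    simp
  cases k with
  | zero =>
    rw [oddFactorial_two_mul_sub_two_zero, mul_zero, scaledNormal_zero (by positivity),
      scaledNormal_two, zero_div, hφ]
    field_simp
    simp
  | succ n =>
    rw [oddFactorial_two_mul_succ_sub_two, show 2 * (n + 1) = 2 * n + 2 by ring,
      scaledNormal_add_two, zero_div, iteratedDeriv_stdNormalPDF, hφ,
      ← Polynomial.coeff_zero_eq_aeval_zero',
      show (Polynomial.hermite (2 * n)).coeff 0 = (-1) ^ n * ((2 * n - 1)‼ : ℕ) by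
        simpa using Polynomial.coeff_hermite_explicit n 0,
      show (1 - ((2 * n + 2 : ℕ) : ℤ)) = 1 - ((2 * (n + 1) : ℕ) : ℤ) by push_cast; ring,
      zpow_sub₀ hs, zpow_one, zpow_natCast, pow_mul, pow_mul, h2]
    simp only [algebraMap_int_eq, Int.coe_castRingHom]
    push_cast
    rw [neg_one_sq, one_pow, pow_succ (-1 : ℝ) n]
    field_simp

lemma kernelConst_eq_sum_oddFactorial {r : ℕ} (hr : 1 ≤ r) :
    kernelConst r = -∑ s ∈ Finset.range r, ∑ t ∈ Finset.range r,
      oddFactorial (2 * (s : ℤ) + 2 * (t : ℤ) - 2) / (2 ^ (2 * s + 2 * t) * (s ! : ℝ) * (t ! : ℝ)) := by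
  rw [kernelConst, psiOne_gaussKernel hr, integral_kernelComb_mul_one_sub hr, Finset.mul_sum,
    ← Finset.sum_neg_distrib]
  refine Finset.sum_congr rfl fun s _ => ?_
  rw [Finset.mul_sum, ← Finset.sum_neg_distrib]
  refine Finset.sum_congr rfl fun t _ => ?_
  rw [kernelCoeff_mul, ← mul_add, scaledNormal_sqrt_two_zero,
    show 2 * ((s + t : ℕ) : ℤ) - 2 = 2 * (s : ℤ) + 2 * (t : ℤ) - 2 by push_cast; ring,
    show 2 * (s + t) = (s + t) + (s + t) by ring, pow_add 2 (s + t) (s + t)]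
  have h1 : ((-1 : ℝ) ^ (s + t)) ^ 2 = 1 := by rw [← pow_mul, mul_comm, pow_mul]; simp
  field_simp
  rw [h1]
  ring

/-! ### The closed form of `C(r)`. -/

/-- The convention `OF(-2) = -1` also fits `Γ(-1/2) = -2√π`, so one formula covers every `k`. -/
lemma Gamma_sub_half_eq_oddFactorial (k : ℕ) :
    Real.Gamma ((k : ℝ) - 1 / 2) = 2 * √Real.pi * oddFactorial (2 * (k : ℤ) - 2) / 2 ^ k := by
  cases k with
  | zero =>
    have h := Real.Gamma_add_one (s := -(1 / 2)) (by norm_num)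
    rw [show -(1 / 2 : ℝ) + 1 = 1 / 2 by norm_num, Real.Gamma_one_half_eq] at h
    rw [oddFactorial_two_mul_sub_two_zero, h]
    norm_num
    ring
  | succ n =>
    rw [oddFactorial_two_mul_succ_sub_two,
      show (((n + 1 : ℕ) : ℝ) - 1 / 2) = n + 1 / 2 by push_cast; ring, Real.Gamma_nat_add_half]
    field_simp
    ring

/-- Writing `1/(s! t!)` as a binomial coefficient over `(s+t)!` leaves a function of `s + t` times
that coefficient, ready for grouping by `N = s + t`. -/
lemma kernelConst_eq_sum_Gamma {r : ℕ} (hr : 1 ≤ r) :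
    kernelConst r = -(1 / (2 * √Real.pi)) * ∑ s ∈ Finset.range r, ∑ t ∈ Finset.range r,
      Real.Gamma (((s + t : ℕ) : ℝ) - 1 / 2) / (2 ^ (s + t) * ((s + t)! : ℝ)) *
        ((s + t).choose s : ℝ) := by
  rw [kernelConst_eq_sum_oddFactorial hr, Finset.mul_sum, ← Finset.sum_neg_distrib]
  refine Finset.sum_congr rfl fun s _ => ?_
  rw [Finset.mul_sum, ← Finset.sum_neg_distrib]
  refine Finset.sum_congr rfl fun t _ => ?_
  rw [Gamma_sub_half_eq_oddFactorial, Nat.cast_add_choose,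
    show 2 * ((s + t : ℕ) : ℤ) - 2 = 2 * (s : ℤ) + 2 * (t : ℤ) - 2 by push_cast; ring,
    show 2 * s + 2 * t = (s + t) + (s + t) by ring, pow_add 2 (s + t) (s + t)]
  have : √Real.pi ≠ 0 := by positivity
  field_simp

/-- This is a primitive of the beta integrand. The derivative of the `j`-th summand is `u j - u (j +
1)`, and the sum telescopes to `u 0` because the binomial coefficient in `u (s + 1)` is zero. -/
lemma hasDerivAt_sum_choose_mul_pow (a s : ℕ) (t : ℝ) :
    HasDerivAt (fun t : ℝ => ∑ j ∈ Finset.range (s + 1),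
        ((a + s + 1).choose (a + j + 1) : ℝ) * (t ^ (a + j + 1) * (1 - t) ^ (s - j)))
      ((a + s + 1 : ℝ) * ((a + s).choose a : ℝ) * (t ^ a * (1 - t) ^ s)) t := by
  set u : ℕ → ℝ := fun j =>
    (a + s + 1 : ℝ) * ((a + s).choose (a + j) : ℝ) * (t ^ (a + j) * (1 - t) ^ (s - j)) with hu
  have hterm : ∀ j ∈ Finset.range (s + 1), HasDerivAt
      (fun t : ℝ => ((a + s + 1).choose (a + j + 1) : ℝ) * (t ^ (a + j + 1) * (1 - t) ^ (s - j)))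
      (u j - u (j + 1)) t := by
    intro j hj
    have hj' : j ≤ s := Nat.lt_succ_iff.mp (Finset.mem_range.mp hj)
    refine (((hasDerivAt_pow (a + j + 1) t).mul
      (((hasDerivAt_id t).const_sub 1).pow (s - j))).const_mul _).congr_deriv ?_
    have h1 : ((a + s + 1).choose (a + j + 1) : ℝ) * (a + j + 1) =
        (a + s + 1) * ((a + s).choose (a + j) : ℝ) := by
      exact_mod_cast (Nat.add_one_mul_choose_eq (a + s) (a + j)).symm
    have h2 : ((a + s + 1).choose (a + j + 1) : ℝ) * ((s - j : ℕ) : ℝ) =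
        (a + s + 1) * ((a + s).choose (a + (j + 1)) : ℝ) := by
      have e1 := Nat.choose_succ_right_eq (a + s) (a + j)
      rw [show a + s - (a + j) = s - j by omega] at e1
      have e2 : ((a + s).choose (a + (j + 1)) : ℝ) * (a + j + 1) =
          ((a + s).choose (a + j) : ℝ) * ((s - j : ℕ) : ℝ) := by exact_mod_cast e1
      have hne : (a + j + 1 : ℝ) ≠ 0 := by positivity
      apply mul_right_cancel₀ hne
      linear_combination ((s - j : ℕ) : ℝ) * h1 - (a + s + 1 : ℝ) * e2
    simp only [hu, id, Nat.add_sub_cancel, Pi.pow_apply]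
    push_cast
    rw [show s - j - 1 = s - (j + 1) by omega, show a + (j + 1) = a + j + 1 by ring] at *
    linear_combination (t ^ (a + j) * (1 - t) ^ (s - j)) * h1 -
      t ^ (a + j + 1) * (1 - t) ^ (s - (j + 1)) * h2
  refine (HasDerivAt.fun_sum hterm).congr_deriv ?_
  rw [Finset.sum_range_sub']
  simp [hu, Nat.choose_eq_zero_of_lt (show a + s < a + (s + 1) by omega)]

/-- The regularized incomplete beta function at `1 / 2` is a symmetric binomial tail. -/
lemma regIncBeta_half (a s : ℕ) :
    regIncBeta (1 / 2) ((a + 1 : ℕ) : ℝ) ((s : ℝ) + 1) =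
      (∑ j ∈ Finset.range (s + 1), ((a + s + 1).choose (a + j + 1) : ℝ)) / 2 ^ (a + s + 1) := by
  have hint := intervalIntegral.integral_eq_sub_of_hasDerivAt
    (fun t _ => hasDerivAt_sum_choose_mul_pow a s t) (a := 0) (b := 1 / 2)
    (Continuous.intervalIntegrable (by fun_prop) _ _)
  rw [intervalIntegral.integral_const_mul] at hint
  have hrpow : ∀ t : ℝ, t ^ (((a + 1 : ℕ) : ℝ) - 1) * (1 - t) ^ ((s : ℝ) + 1 - 1) =
      t ^ a * (1 - t) ^ s := fun t => by
    rw [add_sub_cancel_right, Real.rpow_natCast, Nat.cast_add_one, add_sub_cancel_right,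
      Real.rpow_natCast]
  have hbeta : ProbabilityTheory.beta ((a + 1 : ℕ) : ℝ) ((s : ℝ) + 1) =
      ((a + s + 1 : ℝ) * ((a + s).choose a : ℝ))⁻¹ := by
    rw [ProbabilityTheory.beta, Nat.cast_add_one, Real.Gamma_nat_eq_factorial,
      Real.Gamma_nat_eq_factorial,
      show (a : ℝ) + 1 + (s + 1) = ((a + s + 1 : ℕ) : ℝ) + 1 by push_cast; ring,
      Real.Gamma_nat_eq_factorial, Nat.cast_add_choose, Nat.factorial_succ]
    push_cast
    field_simp
  simp_rw [regIncBeta, hrpow, hbeta]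
  rw [div_inv_eq_mul, mul_comm, hint, Finset.sum_div]
  have h0 : ∑ j ∈ Finset.range (s + 1),
      ((a + s + 1).choose (a + j + 1) : ℝ) * ((0 : ℝ) ^ (a + j + 1) * (1 - 0) ^ (s - j)) = 0 := by
    simp
  rw [h0, sub_zero]
  refine Finset.sum_congr rfl fun j hj => ?_
  have hj' : j ≤ s := Nat.lt_succ_iff.mp (Finset.mem_range.mp hj)
  rw [show (1 - 1 / 2 : ℝ) = 1 / 2 by norm_num, ← pow_add,
    show a + j + 1 + (s - j) = a + s + 1 by omega, one_div, inv_pow, div_eq_mul_inv]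

lemma sum_range_sum_range_eq_sum_antidiagonal (r : ℕ) (f : ℕ → ℝ) :
    ∑ s ∈ Finset.range r, ∑ t ∈ Finset.range r, f (s + t) * ((s + t).choose s : ℝ) =
      ∑ N ∈ Finset.range (2 * r - 1), f N *
        ∑ i ∈ Finset.range (N + 1), if i < r ∧ N - i < r then (N.choose i : ℝ) else 0 := by
  rw [← Finset.sum_product', ← Finset.sum_fiberwise_of_maps_to
    (g := fun p : ℕ × ℕ => p.1 + p.2) (t := Finset.range (2 * r - 1))]
  · refine Finset.sum_congr rfl fun N _ => ?_
    rw [← Finset.sum_filter, Finset.mul_sum]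
    refine Finset.sum_nbij' (fun p => p.1) (fun i => (i, N - i)) ?_ ?_ ?_ ?_ ?_
    · rintro ⟨a, b⟩ h
      simp only [Finset.mem_filter, Finset.mem_product, Finset.mem_range] at h ⊢
      omega
    · intro i h
      simp only [Finset.mem_filter, Finset.mem_product, Finset.mem_range] at h ⊢
      omega
    · rintro ⟨a, b⟩ h
      simp only [Finset.mem_filter, Finset.mem_product, Finset.mem_range] at h ⊢
      rw [← h.2, Nat.add_sub_cancel_left]
    · intro i _
      rfl
    · rintro ⟨a, b⟩ h
      simp only [Finset.mem_filter, Finset.mem_product, Finset.mem_range] at h ⊢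
      rw [h.2]
  · rintro ⟨a, b⟩ h
    simp only [Finset.mem_product, Finset.mem_range] at h ⊢
    omega

/-- The excluded ranges `r ≤ i` and `r ≤ N - i` are disjoint because `N < 2r`, and they have equal
sums by the symmetry of binomial coefficients. -/
lemma sum_choose_central {r N : ℕ} (hN : N < 2 * r) :
    (∑ i ∈ Finset.range (N + 1), if i < r ∧ N - i < r then (N.choose i : ℝ) else 0) =
      2 ^ N - 2 * ∑ i ∈ Finset.range (N + 1), if r ≤ i then (N.choose i : ℝ) else 0 := by
  have h1 : (∑ i ∈ Finset.range (N + 1), if r ≤ N - i then (N.choose i : ℝ) else 0) =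
      ∑ i ∈ Finset.range (N + 1), if r ≤ i then (N.choose i : ℝ) else 0 := by
    rw [← Finset.sum_range_reflect]
    refine Finset.sum_congr rfl fun i hi => ?_
    have hi' : i ≤ N := Nat.lt_succ_iff.mp (Finset.mem_range.mp hi)
    rw [show N + 1 - 1 - i = N - i by omega, show N - (N - i) = i by omega, Nat.choose_symm hi']
  have h2 : (2 : ℝ) ^ N = ∑ i ∈ Finset.range (N + 1), (N.choose i : ℝ) := by
    exact_mod_cast (Nat.sum_range_choose N).symm
  rw [two_mul]
  nth_rewrite 1 [← h1]
  rw [h2, ← Finset.sum_add_distrib, ← Finset.sum_sub_distrib]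
  refine Finset.sum_congr rfl fun i hi => ?_
  have hi' : i ≤ N := Nat.lt_succ_iff.mp (Finset.mem_range.mp hi)
  by_cases ha : r ≤ i
  · rw [if_neg (by omega), if_neg (by omega), if_pos ha]
    ring
  · by_cases hb : r ≤ N - i
    · rw [if_neg (by omega), if_pos hb, if_neg ha]
      ring
    · rw [if_pos (by omega), if_neg hb, if_neg ha]
      ring

lemma sum_choose_upper (r s : ℕ) :
    (∑ i ∈ Finset.range (r + s + 1), if r ≤ i then ((r + s).choose i : ℝ) else 0) =
      ∑ j ∈ Finset.range (s + 1), ((r + s).choose (r + j) : ℝ) := by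
  rw [add_assoc, Finset.sum_range_add]
  rw [Finset.sum_eq_zero, zero_add]
  · exact Finset.sum_congr rfl fun j _ => if_pos (Nat.le_add_right _ _)
  · intro i hi
    exact if_neg (by simpa using hi)

lemma sum_range_sum_range_choose {r : ℕ} (hr : 1 ≤ r) (f : ℕ → ℝ) :
    ∑ s ∈ Finset.range r, ∑ t ∈ Finset.range r, f (s + t) * ((s + t).choose s : ℝ) =
      ∑ N ∈ Finset.range (2 * r - 1), f N * 2 ^ N -
        2 * ∑ s ∈ Finset.range (r - 1), f (r + s) *
          ∑ j ∈ Finset.range (s + 1), ((r + s).choose (r + j) : ℝ) := by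
  rw [sum_range_sum_range_eq_sum_antidiagonal]
  have h1 : ∀ N ∈ Finset.range (2 * r - 1), (f N *
      ∑ i ∈ Finset.range (N + 1), if i < r ∧ N - i < r then (N.choose i : ℝ) else 0) =
      f N * 2 ^ N - 2 * (f N *
        ∑ i ∈ Finset.range (N + 1), if r ≤ i then (N.choose i : ℝ) else 0) := by
    intro N hN
    rw [Finset.mem_range] at hN
    rw [sum_choose_central (by omega)]
    ring
  rw [Finset.sum_congr rfl h1, Finset.sum_sub_distrib, ← Finset.mul_sum]
  congr 2
  -- The tail `r ≤ i ≤ N` is empty for `N < r`, which leaves `N = r + s` with `s < r - 1`.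
  rw [show 2 * r - 1 = r + (r - 1) by omega, Finset.sum_range_add, Finset.sum_eq_zero, zero_add]
  · exact Finset.sum_congr rfl fun s _ => by rw [sum_choose_upper]
  · intro N hN
    rw [Finset.mem_range] at hN
    rw [Finset.sum_eq_zero, mul_zero]
    intro i hi
    rw [Finset.mem_range] at hi
    exact if_neg (by omega)

/-- The sum telescopes through `Γ(K + 3/2) = (K + 1/2) Γ(K + 1/2)`, starting from `Γ(-1/2) = -2
Γ(1/2)`. -/
lemma sum_Gamma_sub_half_div_factorial (K : ℕ) :
    ∑ N ∈ Finset.range (K + 1), Real.Gamma ((N : ℝ) - 1 / 2) / (N ! : ℝ) =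
      -2 * (Real.Gamma ((K : ℝ) + 1 / 2) / (K ! : ℝ)) := by
  induction K with
  | zero =>
    have h := Real.Gamma_add_one (s := -(1 / 2)) (by norm_num)
    rw [show -(1 / 2 : ℝ) + 1 = 1 / 2 by norm_num] at h
    simp only [zero_add, Finset.sum_range_one, Nat.cast_zero, zero_sub, Nat.factorial_zero,
      Nat.cast_one, div_one]
    linarith
  | succ K ih =>
    have h := Real.Gamma_add_one (s := (K : ℝ) + 1 / 2) (by positivity)
    rw [Finset.sum_range_succ, ih,
      show ((K + 1 : ℕ) : ℝ) - 1 / 2 = K + 1 / 2 by push_cast; ring,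
      show ((K + 1 : ℕ) : ℝ) + 1 / 2 = K + 1 / 2 + 1 by push_cast; ring, h, Nat.factorial_succ]
    push_cast
    field_simp
    ring

lemma kernelConst_eq_Gamma_add_sum {r : ℕ} (hr : 1 ≤ r) :
    kernelConst r =
      Real.Gamma (2 * (r : ℝ) - 3 / 2) / (√Real.pi * Real.Gamma (2 * (r : ℝ) - 1))
        + ∑ s ∈ Finset.range (r - 1),
            Real.Gamma ((r : ℝ) + s - 1 / 2) / (√Real.pi * Real.Gamma ((r : ℝ) + s + 1)) *
              regIncBeta (1 / 2) r ((s : ℝ) + 1) := by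
  obtain ⟨a, rfl⟩ : ∃ a, r = a + 1 := ⟨r - 1, by omega⟩
  rw [kernelConst_eq_sum_Gamma hr, sum_range_sum_range_choose hr
    (fun N => Real.Gamma ((N : ℝ) - 1 / 2) / (2 ^ N * (N ! : ℝ)))]
  have h1 : ∀ N ∈ Finset.range (2 * (a + 1) - 1),
      Real.Gamma ((N : ℝ) - 1 / 2) / (2 ^ N * (N ! : ℝ)) * 2 ^ N =
        Real.Gamma ((N : ℝ) - 1 / 2) / (N ! : ℝ) := fun N _ => by field_simp
  rw [Finset.sum_congr rfl h1, show 2 * (a + 1) - 1 = 2 * a + 1 by omega,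
    sum_Gamma_sub_half_div_factorial, mul_sub, sub_eq_add_neg]
  congr 1
  · rw [show 2 * ((a + 1 : ℕ) : ℝ) - 3 / 2 = ((2 * a : ℕ) : ℝ) + 1 / 2 by push_cast; ring,
      show 2 * ((a + 1 : ℕ) : ℝ) - 1 = ((2 * a : ℕ) : ℝ) + 1 by push_cast; ring,
      Real.Gamma_nat_eq_factorial]
    field_simp
  · rw [Finset.mul_sum, Finset.mul_sum, ← Finset.sum_neg_distrib]
    refine Finset.sum_congr rfl fun s _ => ?_
    rw [regIncBeta_half, show ((a + 1 : ℕ) : ℝ) + s + 1 = ((a + 1 + s : ℕ) : ℝ) + 1 by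
      push_cast; ring, Real.Gamma_nat_eq_factorial,
      show ((a + 1 : ℕ) : ℝ) + s - 1 / 2 = ((a + 1 + s : ℕ) : ℝ) - 1 / 2 by push_cast; ring,
      show a + s + 1 = a + 1 + s by ring]
    simp only [show ∀ j, a + j + 1 = a + 1 + j by intro j; ring]
    field_simp

/-- The source of the powers of `h` in `V`: `2s` derivatives of a distribution function at scale `h`
carry a factor `h^{-2s}`. -/
lemma scaledNormal_eq_pow_mul (s : ℕ) {h : ℝ} (hh : 0 < h) (x : ℝ) :
    scaledNormal (2 * s + 1) 1 (h⁻¹ * x) = h ^ (2 * s) * scaledNormal (2 * s + 1) h x := by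
  rw [scaledNormal, scaledNormal, one_zpow, one_mul, div_one, ← mul_assoc, ← zpow_natCast,
    ← zpow_add₀ hh.ne', inv_mul_eq_div]
  push_cast
  ring_nf
  simp

lemma integral_scaledNormal_sub_mul_scaledNormal_sub (k : ℕ) {τ ρ : ℝ} (hτ : 0 < τ) (hρ : 0 < ρ)
    (x μ : ℝ) :
    ∫ y, scaledNormal k τ (x - y) * scaledNormal 2 ρ (y - μ) =
      scaledNormal k (√(τ ^ 2 + ρ ^ 2)) (x - μ) := by
  rw [← integral_scaledNormal_sub_mul k hτ hρ, ← integral_add_right_eq_self _ μ]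
  congr 1 with y
  ring_nf

/-! ### Mean and bias of the estimator under a normal mixture. -/

section Mixture

variable {m : ℕ} {w μ σ : Fin m → ℝ}

lemma mixturePDF_eq_normalComb (hσ : ∀ j, 0 < σ j) :
    mixturePDF w μ σ = normalComb Finset.univ w (fun _ => 0) σ μ 2 := by
  ext x
  refine Finset.sum_congr rfl fun j _ => ?_
  rw [mul_zero, zero_add]
  exact congrArg (w j * ·) (scaledNormal_two_eq_gaussianPDFReal (hσ j)
    (v := ⟨σ j ^ 2, sq_nonneg (σ j)⟩) (by rfl) (μ j) x).symm

lemma mixtureCDF_eq_normalComb (hσ : ∀ j, 0 < σ j) :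
    mixtureCDF w μ σ = normalComb Finset.univ w (fun _ => 0) σ μ 1 := by
  have hσ' : ∀ j ∈ Finset.univ, 0 < σ j := fun j _ => hσ j
  ext x
  rw [mixtureCDF, mixturePDF_eq_normalComb hσ,
    integral_Iic_of_hasDerivAt_of_tendsto' (fun y _ => hasDerivAt_normalComb hσ' 1 y)
      ((expDecay_normalComb_add_two hσ' 0).integrable
        (continuous_normalComb hσ' 2)).integrableOn
      (leftDecay_normalComb hσ' 1).tendsto_atBot, sub_zero]

lemma integral_mixtureMeasure (hw : ∀ j, 0 < w j) (hσ : ∀ j, 0 < σ j) {f : ℝ → ℝ}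
    (hf : ∀ j, Integrable (fun y => f y * scaledNormal 2 (σ j) (y - μ j))) :
    ∫ y, f y ∂(mixtureMeasure w μ σ) = ∑ j, w j * ∫ y, f y * scaledNormal 2 (σ j) (y - μ j) := by
  have hpos : ∀ y, 0 ≤ mixturePDF w μ σ y := fun y =>
    Finset.sum_nonneg fun j _ => mul_nonneg (hw j).le (gaussianPDFReal_nonneg _ _ _)
  have hc : Continuous (mixturePDF w μ σ) := by
    rw [mixturePDF_eq_normalComb hσ]
    exact continuous_normalComb (fun j _ => hσ j) 2
  have hm : Measurable fun y => ENNReal.ofReal (mixturePDF w μ σ y) :=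
    hc.measurable.ennreal_ofReal
  rw [mixtureMeasure, integral_withDensity_eq_integral_toReal_smul hm (ae_of_all _ fun _ => ENNReal.ofReal_lt_top)]
  simp_rw [ENNReal.toReal_ofReal (hpos _), smul_eq_mul, mixturePDF_eq_normalComb hσ, normalComb,
    mul_zero, zero_add, Finset.sum_mul]
  rw [integral_finsetSum]
  · refine Finset.sum_congr rfl fun j _ => ?_
    rw [← integral_const_mul]
    congr 1 with y
    ring
  · intro j _
    exact ((hf j).const_mul (w j)).congr (ae_of_all _ fun y => by ring)

/-- The mean of the kernel distribution function estimator, differentiated `d - 1` times. -/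
def smoothedComb (w μ σ : Fin m → ℝ) (h : ℝ) (r d : ℕ) : ℝ → ℝ :=
  normalComb (Finset.univ ×ˢ Finset.range r)
    (fun k : Fin m × ℕ => w k.1 * (kernelCoeff k.2 * h ^ (2 * k.2))) (fun k => k.2)
    (fun k => √(h ^ 2 + σ k.1 ^ 2)) (fun k => μ k.1) d

lemma integral_kernelComb_mixtureMeasure (hw : ∀ j, 0 < w j) (hσ : ∀ j, 0 < σ j) {h : ℝ}
    (hh : 0 < h) (r : ℕ) (x : ℝ) :
    ∫ y, kernelComb r 1 (h⁻¹ * (x - y)) ∂(mixtureMeasure w μ σ) = smoothedComb w μ σ h r 1 x := by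
  have hi : ∀ j s, Integrable
      (fun y => scaledNormal (2 * s + 1) h (x - y) * scaledNormal 2 (σ j) (y - μ j)) := fun j s => by
    obtain ⟨C, hC⟩ := exists_abs_scaledNormal_succ_le (2 * s) hh
    exact integrable_linGrowth_mul_expDecay (.of_abs_le C fun y => hC _)
      ((expDecay_scaledNormal_add_two 0 (hσ j)).comp_sub (μ j))
      ((continuous_scaledNormal _ hh).comp (continuous_sub_left x))
      ((continuous_scaledNormal 2 (hσ j)).comp (continuous_sub_right (μ j)))
  have hG : ∀ y, kernelComb r 1 (h⁻¹ * (x - y)) = ∑ s ∈ Finset.range r,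
      kernelCoeff s * h ^ (2 * s) * scaledNormal (2 * s + 1) h (x - y) := fun y => by
    simp only [kernelComb, normalComb]
    refine Finset.sum_congr rfl fun s _ => ?_
    rw [sub_zero, scaledNormal_eq_pow_mul s hh, mul_assoc]
  have hi' : ∀ j, ∀ s ∈ Finset.range r, Integrable (fun y => kernelCoeff s * h ^ (2 * s) *
      scaledNormal (2 * s + 1) h (x - y) * scaledNormal 2 (σ j) (y - μ j)) := fun j s _ =>
    ((hi j s).const_mul (kernelCoeff s * h ^ (2 * s))).congr (ae_of_all _ fun y => by ring)
  simp_rw [hG]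
  rw [integral_mixtureMeasure hw hσ, smoothedComb, normalComb, Finset.sum_product]
  · refine Finset.sum_congr rfl fun j _ => ?_
    simp_rw [Finset.sum_mul]
    rw [integral_finsetSum _ (hi' j), Finset.mul_sum]
    refine Finset.sum_congr rfl fun s _ => ?_
    rw [← integral_scaledNormal_sub_mul_scaledNormal_sub _ hh (hσ j), mul_assoc (w j),
      ← integral_const_mul (kernelCoeff s * h ^ (2 * s))]
    simp_rw [mul_assoc]
  · intro j
    simp_rw [Finset.sum_mul]
    exact integrable_finsetSum _ (hi' j)

lemma mixtureV_eq_sum_scaledNormal (h : ℝ) (p q : ℕ) :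
    mixtureV w μ σ h p q = ∑ i, ∑ j, w i * w j *
      (h ^ (2 * p) * scaledNormal (2 * p) (√(σ i ^ 2 + σ j ^ 2 + q * h ^ 2)) (μ j - μ i)) := by
  rw [mixtureV, Finset.mul_sum]
  refine Finset.sum_congr rfl fun i _ => ?_
  rw [Finset.mul_sum]
  refine Finset.sum_congr rfl fun j _ => ?_
  rw [scaledNormal, pairScale]
  push_cast
  ring

/-- Each component of the mean has variance `h² + σ_i²`, so pooling two of them gives the index `q =
2`. -/
lemma sum_smoothed_eq_sum_mixtureV (h : ℝ) (r : ℕ) :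
    (∑ k ∈ (Finset.univ : Finset (Fin m)) ×ˢ Finset.range r,
      ∑ l ∈ (Finset.univ : Finset (Fin m)) ×ˢ Finset.range r,
        w k.1 * (kernelCoeff k.2 * h ^ (2 * k.2)) * (w l.1 * (kernelCoeff l.2 * h ^ (2 * l.2))) *
        scaledNormal (2 * k.2 + 2 * l.2) (√(√(h ^ 2 + σ k.1 ^ 2) ^ 2 + √(h ^ 2 + σ l.1 ^ 2) ^ 2))
          (μ l.1 - μ k.1)) =
      ∑ s ∈ Finset.range r, ∑ t ∈ Finset.range r,
        (-1 : ℝ) ^ (s + t) / (2 ^ (s + t) * (s ! : ℝ) * (t ! : ℝ)) * mixtureV w μ σ h (s + t) 2 := by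
  simp_rw [mixtureV_eq_sum_scaledNormal, ← kernelCoeff_mul, Finset.mul_sum]
  rw [Finset.sum_product_right]
  refine Finset.sum_congr rfl fun s _ => ?_
  simp_rw [Finset.sum_product_right]
  rw [Finset.sum_comm]
  refine Finset.sum_congr rfl fun t _ => Finset.sum_congr rfl fun i _ =>
    Finset.sum_congr rfl fun j _ => ?_
  rw [Real.sq_sqrt (by positivity), Real.sq_sqrt (by positivity), ← mul_add,
    show h ^ 2 + σ i ^ 2 + (h ^ 2 + σ j ^ 2) = σ i ^ 2 + σ j ^ 2 + (2 : ℕ) * h ^ 2 by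
      push_cast; ring]
  ring

lemma sum_kernelCoeff_mul_ite {r : ℕ} (hr : 1 ≤ r) (g : ℕ → ℝ) :
    ∑ s ∈ Finset.range r, kernelCoeff s * g s * (if s = 0 then 1 else 0) = g 0 := by
  simp [kernelCoeff, Nat.pos_iff_ne_zero.mp hr]

lemma smoothedMass (hw1 : ∑ j, w j = 1) (h : ℝ) {r : ℕ} (hr : 1 ≤ r) :
    normalCombMass ((Finset.univ : Finset (Fin m)) ×ˢ Finset.range r)
      (fun k => w k.1 * (kernelCoeff k.2 * h ^ (2 * k.2))) (fun k => k.2) = 1 := by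
  rw [normalCombMass, Finset.sum_product]
  simp_rw [mul_assoc (w _), ← Finset.mul_sum,
    sum_kernelCoeff_mul_ite hr (fun s => h ^ (2 * s)), mul_zero, pow_zero, mul_one, hw1]

lemma smoothedScale_pos {h : ℝ} (hh : 0 < h) (r : ℕ) :
    ∀ k ∈ (Finset.univ : Finset (Fin m)) ×ˢ Finset.range r, 0 < √(h ^ 2 + σ k.1 ^ 2) :=
  fun _ _ => by positivity

lemma integrable_smoothedComb_mul_one_sub (hw1 : ∑ j, w j = 1) {h : ℝ} (hh : 0 < h) {r : ℕ}
    (hr : 1 ≤ r) :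
    Integrable (fun x => smoothedComb w μ σ h r 1 x * (1 - smoothedComb w μ σ h r 1 x)) := by
  rw [← smoothedMass hw1 h hr]
  exact integrable_normalComb_mul_mass_sub (smoothedScale_pos hh r) 1

lemma integral_smoothedComb_mul_one_sub (hw1 : ∑ j, w j = 1) {h : ℝ} (hh : 0 < h) {r : ℕ}
    (hr : 1 ≤ r) :
    ∫ x, smoothedComb w μ σ h r 1 x * (1 - smoothedComb w μ σ h r 1 x) =
      ∑ s ∈ Finset.range r, ∑ t ∈ Finset.range r,
        (-1 : ℝ) ^ (s + t) / (2 ^ (s + t) * (s ! : ℝ) * (t ! : ℝ)) * mixtureV w μ σ h (s + t) 2 := by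
  rw [← sum_smoothed_eq_sum_mixtureV, ← smoothedMass hw1 h hr]
  exact integral_normalComb_mul_mass_sub (smoothedScale_pos hh r)

/-- The bias of the kernel distribution function estimator. -/
def biasComb (w μ σ : Fin m → ℝ) (h : ℝ) (r : ℕ) : ℝ → ℝ :=
  normalComb ((Finset.univ ×ˢ Finset.range r).disjSum Finset.univ)
    (Sum.elim (fun k : Fin m × ℕ => w k.1 * (kernelCoeff k.2 * h ^ (2 * k.2))) (fun j => -w j))
    (Sum.elim (fun k => k.2) (fun _ => 0)) (Sum.elim (fun k => √(h ^ 2 + σ k.1 ^ 2)) σ)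
    (Sum.elim (fun k => μ k.1) μ) 1

lemma biasComb_eq_sub (hσ : ∀ j, 0 < σ j) (h : ℝ) (r : ℕ) (x : ℝ) :
    biasComb w μ σ h r x = smoothedComb w μ σ h r 1 x - mixtureCDF w μ σ x := by
  rw [biasComb, normalComb, Finset.sum_disjSum, mixtureCDF_eq_normalComb hσ, smoothedComb,
    normalComb, normalComb, sub_eq_add_neg, ← Finset.sum_neg_distrib]
  simp

/-- The mean and `F` both tend to `1`. With limit `0`, the integrand `M (κ - M)` of the central
identity is minus the squared bias. -/
lemma biasMass (hw1 : ∑ j, w j = 1) (h : ℝ) {r : ℕ} (hr : 1 ≤ r) :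
    normalCombMass ((Finset.univ ×ˢ Finset.range r).disjSum (Finset.univ : Finset (Fin m)))
      (Sum.elim (fun k : Fin m × ℕ => w k.1 * (kernelCoeff k.2 * h ^ (2 * k.2))) (fun j => -w j))
      (Sum.elim (fun k => k.2) (fun _ => 0)) = 0 := by
  have h1 := smoothedMass hw1 h hr
  rw [normalCombMass] at h1
  rw [normalCombMass, Finset.sum_disjSum]
  simp only [Sum.elim_inl, Sum.elim_inr, if_true, mul_one, Finset.sum_neg_distrib, hw1]
  exact (congrArg (· + -1) h1).trans (by norm_num)

lemma biasScale_pos (hσ : ∀ j, 0 < σ j) {h : ℝ} (hh : 0 < h) (r : ℕ) :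
    ∀ k ∈ (Finset.univ ×ˢ Finset.range r).disjSum (Finset.univ : Finset (Fin m)),
      0 < Sum.elim (fun k : Fin m × ℕ => √(h ^ 2 + σ k.1 ^ 2)) σ k := by
  rintro (k | j) _
  · simp only [Sum.elim_inl]
    positivity
  · exact hσ j

lemma integrable_biasComb_sq (hw1 : ∑ j, w j = 1) (hσ : ∀ j, 0 < σ j) {h : ℝ} (hh : 0 < h) {r : ℕ}
    (hr : 1 ≤ r) : Integrable (fun x => biasComb w μ σ h r x ^ 2) := by
  have h1 := integrable_normalComb_mul_mass_sub (c := (Sum.elim (fun k : Fin m × ℕ =>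
    w k.1 * (kernelCoeff k.2 * h ^ (2 * k.2))) (fun j => -w j)))
    (e := Sum.elim (fun k => k.2) (fun _ => 0)) (μ := Sum.elim (fun k => μ k.1) μ)
    (biasScale_pos hσ hh r) 1
  rw [biasMass hw1 h hr] at h1
  refine h1.neg.congr (ae_of_all _ fun x => ?_)
  simp only [Pi.neg_apply, biasComb]
  ring

lemma integral_biasComb_sq (hw1 : ∑ j, w j = 1) (hσ : ∀ j, 0 < σ j) {h : ℝ} (hh : 0 < h) {r : ℕ}
    (hr : 1 ≤ r) : ∫ x, biasComb w μ σ h r x ^ 2 =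
      -(∑ s ∈ Finset.range r, ∑ t ∈ Finset.range r,
          (-1 : ℝ) ^ (s + t) / (2 ^ (s + t) * (s ! : ℝ) * (t ! : ℝ)) *
            mixtureV w μ σ h (s + t) 2)
        + 2 * ∑ s ∈ Finset.range r,
            (-1 : ℝ) ^ s / (2 ^ s * (s ! : ℝ)) * mixtureV w μ σ h s 1
        - mixtureV w μ σ h 0 0 := by
  have h1 := integral_normalComb_mul_mass_sub (c := (Sum.elim (fun k : Fin m × ℕ =>
    w k.1 * (kernelCoeff k.2 * h ^ (2 * k.2))) (fun j => -w j)))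
    (e := Sum.elim (fun k => k.2) (fun _ => 0)) (μ := Sum.elim (fun k => μ k.1) μ)
    (biasScale_pos hσ hh r)
  rw [biasMass hw1 h hr] at h1
  simp only [Finset.sum_disjSum, Sum.elim_inl, Sum.elim_inr, zero_sub, mul_neg, integral_neg,
    Finset.sum_add_distrib, sum_smoothed_eq_sum_mixtureV] at h1
  have h2 : ∫ x, biasComb w μ σ h r x ^ 2 = ∫ x, biasComb w μ σ h r x * biasComb w μ σ h r x := by
    simp_rw [sq]
  -- Pairing the mean with `F` involves a single `h²`, hence `q = 1`. The two orders of the pair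
  -- give equal sums, whence the factor `2`.
  have hcross : ∑ k ∈ (Finset.univ : Finset (Fin m)) ×ˢ Finset.range r, ∑ j,
      w k.1 * (kernelCoeff k.2 * h ^ (2 * k.2)) * w j *
        scaledNormal (2 * k.2 + 2 * 0) (√(√(h ^ 2 + σ k.1 ^ 2) ^ 2 + σ j ^ 2)) (μ j - μ k.1) =
      ∑ s ∈ Finset.range r, kernelCoeff s * mixtureV w μ σ h s 1 := by
    simp_rw [mixtureV_eq_sum_scaledNormal, Finset.mul_sum]
    rw [Finset.sum_product_right]
    refine Finset.sum_congr rfl fun s _ => Finset.sum_congr rfl fun i _ =>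
      Finset.sum_congr rfl fun j _ => ?_
    rw [Real.sq_sqrt (by positivity),
      show h ^ 2 + σ i ^ 2 + σ j ^ 2 = σ i ^ 2 + σ j ^ 2 + (1 : ℕ) * h ^ 2 by push_cast; ring]
    ring_nf
  have hcross' : ∑ j, ∑ k ∈ (Finset.univ : Finset (Fin m)) ×ˢ Finset.range r,
      w j * (w k.1 * (kernelCoeff k.2 * h ^ (2 * k.2))) *
        scaledNormal (2 * 0 + 2 * k.2) (√(σ j ^ 2 + √(h ^ 2 + σ k.1 ^ 2) ^ 2)) (μ k.1 - μ j) =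
      ∑ s ∈ Finset.range r, kernelCoeff s * mixtureV w μ σ h s 1 := by
    simp_rw [mixtureV_eq_sum_scaledNormal, Finset.mul_sum, Finset.sum_product_right]
    rw [Finset.sum_comm]
    refine Finset.sum_congr rfl fun s _ => Finset.sum_congr rfl fun i _ =>
      Finset.sum_congr rfl fun j _ => ?_
    rw [Real.sq_sqrt (by positivity),
      show σ i ^ 2 + (h ^ 2 + σ j ^ 2) = σ i ^ 2 + σ j ^ 2 + (1 : ℕ) * h ^ 2 by push_cast; ring]
    ring_nf
  have hV0 : ∑ i, ∑ j, w i * w j * scaledNormal (2 * 0 + 2 * 0) (√(σ i ^ 2 + σ j ^ 2)) (μ j - μ i) =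
      mixtureV w μ σ h 0 0 := by
    simp [mixtureV_eq_sum_scaledNormal]
  simp only [neg_mul, neg_neg, Finset.sum_neg_distrib, hcross, hcross', hV0] at h1
  rw [h2]
  change -∫ x, biasComb w μ σ h r x * biasComb w μ σ h r x = _ at h1
  simp only [kernelCoeff] at h1
  linarith

end Mixture

/-! ### Integration over `x` and the moments of the estimator. -/

/-- Tonelli for a convolution with a probability measure, after rescaling. -/
lemma integral_integral_comp_inv_mul_sub {ν : Measure ℝ} [IsProbabilityMeasure ν] {H : ℝ → ℝ}
    (hH : Integrable H) (hc : Continuous H) {h : ℝ} (hh : 0 < h) :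
    Integrable (fun x => ∫ y, H (h⁻¹ * (x - y)) ∂ν) ∧
      ∫ x, ∫ y, H (h⁻¹ * (x - y)) ∂ν = h * ∫ x, H x := by
  have hscale : ∀ (K : ℝ → ℝ) (y : ℝ), ∫ x, K (h⁻¹ * (x - y)) = h * ∫ x, K x := fun K y => by
    rw [integral_sub_right_eq_self (fun x => K (h⁻¹ * x)) y, Measure.integral_comp_mul_left,
      inv_inv, abs_of_pos hh, smul_eq_mul]
  have hint : Integrable (Function.uncurry fun x y => H (h⁻¹ * (x - y))) (volume.prod ν) := by
    -- The norm of each slice in `x` integrates to `h ∫ ‖H‖`, independently of `y`, and this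
    -- constant is integrable against a probability measure.
    refine (integrable_prod_iff' (Continuous.aestronglyMeasurable ?_)).mpr ⟨ae_of_all _ fun y => ?_, ?_⟩
    · exact hc.comp (by fun_prop)
    · exact (hH.comp_mul_left' (inv_ne_zero hh.ne')).comp_sub_right y
    · simp only [Function.uncurry]
      simp_rw [hscale (fun x => ‖H x‖)]
      exact integrable_const _
  refine ⟨hint.integral_prod_left, ?_⟩
  rw [integral_integral_swap hint]
  simp_rw [hscale H]
  simp

section Estimator

variable {Ω : Type*} [MeasurableSpace Ω] {P : Measure Ω} [IsProbabilityMeasure P] {m n : ℕ}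
  {w μ σ : Fin m → ℝ} {X : Fin n → Ω → ℝ}

lemma memLp_comp_of_bounded {ν : Measure ℝ} {Y : Ω → ℝ} (hY : HasLaw Y ν P) {g : ℝ → ℝ}
    (hg : Continuous g) {C : ℝ} (hC : ∀ x, |g x| ≤ C) : MemLp (fun ω => g (Y ω)) 2 P :=
  .of_bound (hg.measurable.comp_aemeasurable hY.aemeasurable).aestronglyMeasurable C
    (ae_of_all _ fun _ => hC _)

lemma memLp_kdfe {ν : Measure ℝ} (hlaw : ∀ i, HasLaw (X i) ν P) {K : ℝ → ℝ} (hK : Continuous K)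
    {C : ℝ} (hC : ∀ x, |K x| ≤ C) (h x : ℝ) : MemLp (kdfe K X h x) 2 P :=
  (memLp_finsetSum _ fun i _ => memLp_comp_of_bounded (hlaw i)
    (hK.comp (by fun_prop : Continuous fun y : ℝ => h⁻¹ * (x - y))) fun _ => hC _).const_mul _

lemma integral_kdfe (hn : 1 ≤ n) {ν : Measure ℝ} (hlaw : ∀ i, HasLaw (X i) ν P) {K : ℝ → ℝ}
    (hK : Continuous K) {C : ℝ} (hC : ∀ x, |K x| ≤ C) (h x : ℝ) :
    ∫ ω, kdfe K X h x ω ∂P = ∫ y, K (h⁻¹ * (x - y)) ∂ν := by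
  have hKx : Continuous fun y : ℝ => K (h⁻¹ * (x - y)) := hK.comp (by fun_prop)
  have hi : ∀ i, Integrable (fun ω => K (h⁻¹ * (x - X i ω))) P := fun i =>
    (memLp_comp_of_bounded (hlaw i) hKx fun _ => hC _).integrable one_le_two
  have he : ∀ i, ∫ ω, K (h⁻¹ * (x - X i ω)) ∂P = ∫ y, K (h⁻¹ * (x - y)) ∂ν := fun i =>
    (hlaw i).integral_comp hKx.aestronglyMeasurable
  have hn0 : (n : ℝ) ≠ 0 := by positivity
  simp only [kdfe]
  rw [integral_const_mul, integral_finsetSum _ fun i _ => hi i, Finset.sum_congr rfl fun i _ => he i]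
  simp [hn0]

lemma variance_kdfe (hn : 1 ≤ n) {ν : Measure ℝ} [IsProbabilityMeasure ν]
    (hindep : iIndepFun X P) (hlaw : ∀ i, HasLaw (X i) ν P) {K : ℝ → ℝ}
    (hK : Continuous K) {C : ℝ} (hC : ∀ x, |K x| ≤ C) (h x : ℝ) :
    variance (kdfe K X h x) P =
      (n : ℝ)⁻¹ * (∫ y, K (h⁻¹ * (x - y)) ^ 2 ∂ν - (∫ y, K (h⁻¹ * (x - y)) ∂ν) ^ 2) := by
  have hKx : Continuous fun y : ℝ => K (h⁻¹ * (x - y)) := hK.comp (by fun_prop)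
  have hmem : ∀ i, MemLp (fun ω => K (h⁻¹ * (x - X i ω))) 2 P := fun i =>
    memLp_comp_of_bounded (hlaw i) hKx fun _ => hC _
  have hvar : ∀ i, variance (fun ω => K (h⁻¹ * (x - X i ω))) P =
      ∫ y, K (h⁻¹ * (x - y)) ^ 2 ∂ν - (∫ y, K (h⁻¹ * (x - y)) ∂ν) ^ 2 := fun i => by
    rw [variance_eq_sub (hmem i)]
    congr 2
    · exact (hlaw i).integral_comp (hKx.pow 2).aestronglyMeasurable
    · exact (hlaw i).integral_comp hKx.aestronglyMeasurable
  have hfun : kdfe K X h x =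
      fun ω => (n : ℝ)⁻¹ * (∑ i, fun ω => K (h⁻¹ * (x - X i ω))) ω := by
    ext ω
    simp [kdfe]
  have hn0 : (n : ℝ) ≠ 0 := by positivity
  rw [hfun, variance_const_mul, IndepFun.variance_sum (fun i _ => hmem i),
    Finset.sum_congr rfl fun i _ => hvar i, Finset.sum_const, Finset.card_univ, Fintype.card_fin,
    nsmul_eq_mul]
  · field_simp
  · intro i _ j _ hij
    exact (hindep.indepFun hij).comp hKx.measurable hKx.measurable

/-- The mean of `K²` and the squared mean both tend to `1` at `+∞` when `r ≥ 1`, so neither is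
integrable in `x`. Writing `K² = K - K (1 - K)` splits the variance into two parts that are. -/
lemma variance_kdfe_gaussKernelCDF (hn : 1 ≤ n) (hw : ∀ j, 0 < w j) (hσ : ∀ j, 0 < σ j)
    [IsProbabilityMeasure (mixtureMeasure w μ σ)] (hindep : iIndepFun X P)
    (hlaw : ∀ i, HasLaw (X i) (mixtureMeasure w μ σ) P) {h : ℝ} (hh : 0 < h) (r : ℕ) (x : ℝ) :
    variance (kdfe (gaussKernelCDF r) X h x) P =
      (n : ℝ)⁻¹ * (smoothedComb w μ σ h r 1 x * (1 - smoothedComb w μ σ h r 1 x) -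
        ∫ y, kernelComb r 1 (h⁻¹ * (x - y)) * (1 - kernelComb r 1 (h⁻¹ * (x - y)))
          ∂(mixtureMeasure w μ σ)) := by
  obtain ⟨C, hC⟩ := exists_abs_kernelComb_one_le r
  have hKx : Continuous fun y : ℝ => kernelComb r 1 (h⁻¹ * (x - y)) :=
    (continuous_kernelComb r 1).comp (by fun_prop)
  have hmem : MemLp (fun y => kernelComb r 1 (h⁻¹ * (x - y))) 2 (mixtureMeasure w μ σ) :=
    memLp_comp_of_bounded HasLaw.id hKx fun _ => hC _
  rw [gaussKernelCDF_eq_kernelComb, variance_kdfe hn hindep hlaw (continuous_kernelComb r 1) hC]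
  have h1 : ∀ y, kernelComb r 1 (h⁻¹ * (x - y)) * (1 - kernelComb r 1 (h⁻¹ * (x - y))) =
      kernelComb r 1 (h⁻¹ * (x - y)) - kernelComb r 1 (h⁻¹ * (x - y)) ^ 2 := fun y => by ring
  simp_rw [h1]
  rw [integral_sub (hmem.integrable one_le_two) hmem.integrable_sq,
    integral_kernelComb_mixtureMeasure hw hσ hh]
  ring

end Estimator

end

theorem theorem1 {Ω : Type*} [MeasurableSpace Ω] (P : Measure Ω) [IsProbabilityMeasure P]
    {m n : ℕ} (hn : 1 ≤ n) (w μ σ : Fin m → ℝ)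
    (hw : ∀ j, 0 < w j) (hw1 : ∑ j, w j = 1) (hσ : ∀ j, 0 < σ j)
    (X : Fin n → Ω → ℝ) (hindep : iIndepFun X P)
    (hlaw : ∀ i, HasLaw (X i) (mixtureMeasure w μ σ) P)
    (h : ℝ) (hh : 0 < h) (r : ℕ) (hr : 1 ≤ r) :
    -- all moments and integrals involved exist
    (∀ x, MemLp (kdfe (gaussKernelCDF r) X h x) 2 P) ∧
    Integrable (fun x => ((∫ ω, kdfe (gaussKernelCDF r) X h x ω ∂P) - mixtureCDF w μ σ x) ^ 2) ∧
    Integrable (fun x => variance (kdfe (gaussKernelCDF r) X h x) P) ∧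
    Integrable (fun x => x * gaussKernelCDF r x * gaussKernel r x) ∧
    -- integrated squared bias
    integratedSqBias P (kdfe (gaussKernelCDF r) X h) (mixtureCDF w μ σ) =
      -(∑ s ∈ Finset.range r, ∑ t ∈ Finset.range r,
          (-1 : ℝ) ^ (s + t) / (2 ^ (s + t) * (s ! : ℝ) * (t ! : ℝ)) *
            mixtureV w μ σ h (s + t) 2)
        + 2 * ∑ s ∈ Finset.range r,
            (-1 : ℝ) ^ s / (2 ^ s * (s ! : ℝ)) * mixtureV w μ σ h s 1
        - mixtureV w μ σ h 0 0 ∧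
    -- integrated variance
    integratedVar P (kdfe (gaussKernelCDF r) X h) =
      -(h / (n * √Real.pi)) * kernelConst r
        + 1 / n * ∑ s ∈ Finset.range r, ∑ t ∈ Finset.range r,
            (-1 : ℝ) ^ (s + t) / (2 ^ (s + t) * (s ! : ℝ) * (t ! : ℝ)) *
              mixtureV w μ σ h (s + t) 2 ∧
    -- the constant, as a double sum and in closed form
    kernelConst r =
      -∑ s ∈ Finset.range r, ∑ t ∈ Finset.range r,
          oddFactorial (2 * (s : ℤ) + 2 * (t : ℤ) - 2) /
            (2 ^ (2 * s + 2 * t) * (s ! : ℝ) * (t ! : ℝ)) ∧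
    kernelConst r =
      Real.Gamma (2 * (r : ℝ) - 3 / 2) / (√Real.pi * Real.Gamma (2 * (r : ℝ) - 1))
        + ∑ s ∈ Finset.range (r - 1),
            Real.Gamma ((r : ℝ) + s - 1 / 2) / (√Real.pi * Real.Gamma ((r : ℝ) + s + 1)) *
              regIncBeta (1 / 2) r ((s : ℝ) + 1) := by
  -- The mixture is the law of an observation under a probability measure; `n ≥ 1` supplies the
  -- observation.
  have hν : IsProbabilityMeasure (mixtureMeasure w μ σ) :=
    (hlaw ⟨0, hn⟩).isProbabilityMeasure_iff.mp inferInstance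
  obtain ⟨C, hC⟩ := exists_abs_kernelComb_one_le r
  have hbias : ∀ x, (∫ ω, kdfe (gaussKernelCDF r) X h x ω ∂P) - mixtureCDF w μ σ x =
      biasComb w μ σ h r x := fun x => by
    rw [gaussKernelCDF_eq_kernelComb, integral_kdfe hn hlaw (continuous_kernelComb r 1) hC,
      integral_kernelComb_mixtureMeasure hw hσ hh, biasComb_eq_sub hσ]
  have hvar := variance_kdfe_gaussKernelCDF hn hw hσ hindep hlaw hh r
  have hsm := integrable_smoothedComb_mul_one_sub (μ := μ) (σ := σ) hw1 hh hr
  obtain ⟨hfub, hfub'⟩ := integral_integral_comp_inv_mul_sub (ν := mixtureMeasure w μ σ)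
    (integrable_kernelComb_mul_one_sub hr)
    ((continuous_kernelComb r 1).mul (continuous_const.sub (continuous_kernelComb r 1))) hh
  refine ⟨fun x => ?_, ?_, ?_, ?_, ?_, ?_, kernelConst_eq_sum_oddFactorial hr,
    kernelConst_eq_Gamma_add_sum hr⟩
  · rw [gaussKernelCDF_eq_kernelComb]
    exact memLp_kdfe hlaw (continuous_kernelComb r 1) hC h x
  · simp_rw [hbias]
    exact integrable_biasComb_sq hw1 hσ hh hr
  · simp_rw [hvar]
    exact (hsm.sub hfub).const_mul _
  · rw [gaussKernelCDF_eq_kernelComb, gaussKernel_eq_kernelComb]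
    exact integrable_mul_kernelComb r
  · simp_rw [integratedSqBias, hbias]
    exact integral_biasComb_sq hw1 hσ hh hr
  · simp_rw [integratedVar, hvar]
    rw [integral_const_mul, integral_sub hsm hfub, hfub',
      integral_smoothedComb_mul_one_sub hw1 hh hr, kernelConst, psiOne_gaussKernel hr]
    field_simp
    ring
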